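/- **Setting.** Let $\mathbb F$ be a finite field, $\theta$ an automorphism of $\mathbb F$, and $\mathcal R=\mathbb F[x;\theta]$ the skew polynomial ring, with $xa=\theta(a)x$ for $a\in\mathbb F$. For $a,b\in\mathcal R$ with $b\neq 0$, $a \bmod b$ is the unique $r\in\mathcal R$ with $\deg r<\deg b$ and $a=r+db$ for some $d\in\mathcal R$. The leading position of a vector $(v_0,\dots,v_\ell)\ne 0$ over $\mathcal R$ is the largest $i$ for which $\deg v_i$ is maximal, and the maximal degree is the degree of the vector. The input consists of $\ell\ge 1$, of $s_i,g_i\in\mathcal R$ with $\deg s_i\le\deg g_i$ for $i=1,\dots,\ell$, and of integers $\gamma_0,\dots,\gamma_\ell\ge 0$. Put $\tilde s_i=s_ix^{\gamma_i}$, $\tilde g_i=g_ix^{\gamma_i}$ and $\mu=\max_{1\le i\le\ell}(\gamma_i+\deg g_i)$. **Demand-driven algorithm.** 1. $(\eta,h)\leftarrow$ (degree, leading position) of $(x^{\gamma_0},\tilde s_1,\dots,\tilde s_\ell)$. If $h=0$, return $(1,0,\dots,0)$. 2. $(\lambda_0,\dots,\lambda_\ell)\leftarrow(x^{\gamma_0},0,\dots,0)$,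 and $\alpha_jx^{\eta_j}\leftarrow$ the leading monomial of $\tilde g_j$ for $j=1,\dots,\ell$. 3. While $\deg\lambda_0\le\eta$: - $\alpha\leftarrow$ the coefficient of $x^\eta$ in $(\lambda_0x^{-\gamma_0})\tilde s_h \bmod \tilde g_h$; - if $\alpha\ne 0$: if $\eta<\eta_h$, swap $(\lambda_0,\alpha,\eta)$ and $(\lambda_h,\alpha_h,\eta_h)$; then $\lambda_0\leftarrow\lambda_0-\frac{\alpha}{\theta^{\eta-\eta_h}(\alpha_h)}\,x^{\eta-\eta_h}\lambda_h$; - $(\eta,h)\leftarrow(\eta,h-1)$ if $h>1$, and $(\eta,h)\leftarrow(\eta-1,\ell)$ otherwise. 4. Return $(\lambda_0x^{-\gamma_0},\dots,\lambda_\ell x^{-\gamma_0})$. **Cost model.** A realisation of the algorithm stores polynomials by their coefficients, in registers that hold elements of $\mathbb F$. The operations $+,-,\cdot,/$, $\theta^i$, writing a constant $0$ or $1$, and testing an element for zero cost one operation each; computations with integers (degrees, indices, addresses) are free. It goes through the same passes of the loop as the algorithm, holds the variables of the algorithm at the head of each pass, and returns the output of the algorithm; what it executes may depend on $\ell$, the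 $\gamma_i$ and the $\deg g_i$, and on the outcomes of its tests for zero. **Theorem.** There are one realisation of the demand-driven algorithm and one absolute constant $K$ such that, for all $\mathbb F$, $\theta$ and all inputs as above in which $g_i=x^{d_i}+a_i$ with $d_i\in\mathbb Z_{>0}$ and $a_i\in\mathbb F$ for every $i=1,\dots,\ell$, the algorithm terminates and the realisation executes at most $K\,\ell\mu^2$ operations. That is, the demand-driven algorithm can be realised with complexity $O(\ell\mu^2)$ for such inputs. -/

import Mathlib

open SkewPolynomial

noncomputable section

namespace SkewRowReduction

/-! ### Skew polynomials

`SkewPolynomial F` is `F[x; θ]`, with `x a = θ(a) x`, where `θ` is the endomorphism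
`SkewPolynomial.φ` by which the generator of `Multiplicative ℕ` acts on `F`.  For a finite field
`F` the endomorphism `θ` is automatically an automorphism, and every automorphism of `F` arises
from exactly one such action. -/

section Polynomials

variable {F : Type*} [Field F]

/-- The degree, with `degree 0 = ⊥`. -/
def degree (p : SkewPolynomial F) : WithBot ℕ := p.support.max

/-- The degree as a natural number, with value `0` at `0`. -/
def natDegree (p : SkewPolynomial F) : ℕ := p.support.sup id

/-- The coefficient of the leading monomial. -/
def leadingCoeff (p : SkewPolynomial F) : F := p.coeff (natDegree p)

/-- `p x^{-k}`: every monomial `a x^n` becomes `a x^{n-k}` (monomials of degree `< k` are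
dropped; the map is the inverse of `p ↦ p x^k` on the multiples `p x^k`). -/
def divXPow (p : SkewPolynomial F) (k : ℕ) : SkewPolynomial F :=
  p.sum fun n a => if k ≤ n then monomial (n - k) a else 0

variable [MulSemiringAction (Multiplicative ℕ) F]

lemma coeff_mul_eq (p b : SkewPolynomial F) (n : ℕ) :
    (p * b).coeff n =
      ∑ i ∈ p.support, if i ≤ n then p.coeff i * φ^[i] (b.coeff (n - i)) else 0 := by
  have h1 : ∀ (k : ℕ) (c : F), (monomial k c * b).coeff n =
      if k ≤ n then c * φ^[k] (b.coeff (n - k)) else 0 := by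
    intro k c
    induction b using SkewPolynomial.induction with
    | h0 => simp
    | ha m r q _ _ ih =>
      rw [mul_add, coeff_add, ih, monomial_mul_monomial, coeff_monomial, coeff_add, coeff_monomial]
      by_cases hk : k ≤ n
      · by_cases hm : k + m = n
        · have : m = n - k := by omega
          simp [hk, this, mul_add, iterate_map_add]
        · have : m ≠ n - k := by omega
          simp [hk, hm, this]
      · have : k + m ≠ n := by omega
        simp [hk, this]
  conv_lhs => rw [← sum_monomial p, sum_def, Finset.sum_mul]
  have h2 : ∀ (t : Finset ℕ) (f : ℕ → SkewPolynomial F),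
      (∑ i ∈ t, f i).coeff n = ∑ i ∈ t, (f i).coeff n := by
    intro t f
    induction t using Finset.cons_induction with
    | empty => simp
    | cons i t hi ih => rw [Finset.sum_cons, Finset.sum_cons, coeff_add, ih]
  rw [h2]
  exact Finset.sum_congr rfl fun i _ => h1 i _

/-- The right modulo operation is well defined. -/
theorem existsUnique_rmod (a b : SkewPolynomial F) (hb : b ≠ 0) :
    ∃! r, degree r < degree b ∧ ∃ d, a = r + d * b := by
  have hsupp : b.support.Nonempty := Finset.nonempty_iff_ne_empty.2 (by simpa using hb)
  obtain ⟨D, hD⟩ := Finset.max_of_nonempty hsupp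
  have hbD : b.coeff D ≠ 0 := mem_support_iff.1 (Finset.mem_of_max hD)
  have hbig : ∀ n, D < n → b.coeff n = 0 := fun n hn => by
    by_contra h
    exact absurd (Finset.le_max_of_eq (mem_support_iff.2 h) hD) (by omega)
  have hdeg : ∀ r : SkewPolynomial F, degree r < degree b ↔ ∀ n, D ≤ n → r.coeff n = 0 := by
    intro r
    unfold degree
    rw [hD, Finset.max_eq_sup_withBot, Finset.sup_lt_iff (WithBot.bot_lt_coe D)]
    constructor
    · intro h n hn
      by_contra hne
      have := h n (mem_support_iff.2 hne)
      exact absurd (WithBot.coe_lt_coe.1 this) (by omega)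
    · intro h n hn
      by_contra hlt
      refine mem_support_iff.1 hn (h n ?_)
      by_contra hc
      exact hlt (WithBot.coe_lt_coe.2 (by omega))
  have hφ : ∀ (i : ℕ) (x : F), x ≠ 0 → φ^[i] x ≠ 0 := by
    intro i x hx h
    exact hx ((φ (R := F)).injective.iterate i (by rw [h, iterate_map_zero]))
  have hex : ∀ N, ∀ a : SkewPolynomial F, (∀ n, N ≤ n → a.coeff n = 0) →
      ∃ r d, (∀ n, D ≤ n → r.coeff n = 0) ∧ a = r + d * b := by
    intro N
    induction N with
    | zero => exact fun a ha => ⟨a, 0, fun n _ => ha n (Nat.zero_le n), by simp⟩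
    | succ N ih =>
      intro a ha
      by_cases hN : N < D
      · exact ⟨a, 0, fun n hn => ha n (by omega), by simp⟩
      have hc : ∀ n, ((monomial (N - D) (a.coeff N / φ^[N - D] (b.coeff D))) * b).coeff n =
          if N - D ≤ n then a.coeff N / φ^[N - D] (b.coeff D) * φ^[N - D] (b.coeff (n - (N - D)))
            else 0 := by
        intro n
        by_cases h0 : a.coeff N / φ^[N - D] (b.coeff D) = 0
        · simp [h0]
        · rw [coeff_mul_eq]
          have : (monomial (N - D) (a.coeff N / φ^[N - D] (b.coeff D))).support = {N - D} := by
            ext j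
            rw [mem_support_iff, coeff_monomial, Finset.mem_singleton]
            by_cases hj : N - D = j
            · simp only [hj, if_true, iff_true]; rw [← hj]; exact h0
            · simp [hj, Ne.symm hj]
          rw [this, Finset.sum_singleton, coeff_monomial, if_pos rfl]
      obtain ⟨r, d, hr, hd⟩ :=
        ih (a - monomial (N - D) (a.coeff N / φ^[N - D] (b.coeff D)) * b) (by
          intro n hn
          rw [coeff_sub, hc, if_pos (by omega)]
          rcases Nat.lt_or_ge N n with h | h
          · rw [ha n h, hbig (n - (N - D)) (by omega), iterate_map_zero]; simp
          · have h1 : n = N := le_antisymm h hn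
            have h2 : N - (N - D) = D := by omega
            rw [h1, h2, div_mul_cancel₀ _ (hφ _ _ hbD), sub_self])
      exact ⟨r, d + monomial (N - D) (a.coeff N / φ^[N - D] (b.coeff D)), hr, by
        rw [add_mul, ← add_assoc, ← hd, sub_add_cancel]⟩
  obtain ⟨r, d, hr, hd⟩ := hex (a.support.sup id + 1) a fun n hn => by
    by_contra h
    have := Finset.le_sup (f := id) (mem_support_iff.2 h)
    simp only [id] at this
    omega
  refine ⟨r, ⟨(hdeg r).2 hr, d, hd⟩, ?_⟩
  rintro r' ⟨hr', d', hd'⟩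
  rw [hdeg] at hr'
  have heq : (d - d') * b = r' - r := by
    rw [sub_mul, sub_eq_sub_iff_add_eq_add, add_comm, ← hd, hd']
  by_cases hdd : d - d' = 0
  · rw [hdd, zero_mul] at heq
    exact sub_eq_zero.1 heq.symm
  · exfalso
    have hs : (d - d').support.Nonempty := Finset.nonempty_iff_ne_empty.2 (by simpa using hdd)
    obtain ⟨k, hk⟩ := Finset.max_of_nonempty hs
    have hk0 := mem_support_iff.1 (Finset.mem_of_max hk)
    have h1 : ((d - d') * b).coeff (k + D) = 0 := by
      rw [heq, coeff_sub, hr' _ (by omega), hr _ (by omega), sub_self]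
    rw [coeff_mul_eq, Finset.sum_eq_single k] at h1
    · rw [if_pos (by omega), Nat.add_sub_cancel_left] at h1
      exact mul_ne_zero hk0 (hφ _ _ hbD) h1
    · intro i hi hik
      have : i ≤ k := Finset.le_max_of_eq hi hk
      rw [hbig (k + D - i) (by omega), iterate_map_zero]
      simp
    · exact fun h => absurd (Finset.mem_of_max hk) h

/-- The right modulo operation: `a mod b` is the polynomial `r` with `deg r < deg b` and
`a = r + d b` for some `d` (it exists and is unique for `b ≠ 0`, see `existsUnique_rmod`). -/
def rmod (a b : SkewPolynomial F) : SkewPolynomial F :=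
  Classical.epsilon fun r => degree r < degree b ∧ ∃ d, a = r + d * b

end Polynomials

section Vectors

variable {F : Type*} [Field F] {ℓ : ℕ}

/-- The degree of a vector: the maximum of the degrees of its entries. -/
def vecDegree (v : Fin (ℓ + 1) → SkewPolynomial F) : WithBot ℕ :=
  Finset.univ.sup fun i => degree (v i)

lemma leadingPositions_nonempty (v : Fin (ℓ + 1) → SkewPolynomial F) :
    (Finset.univ.filter fun i => degree (v i) = vecDegree v).Nonempty := by
  obtain ⟨i, -, hi⟩ := Finset.exists_mem_eq_sup Finset.univ Finset.univ_nonempty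
    fun i => degree (v i)
  exact ⟨i, Finset.mem_filter.2 ⟨Finset.mem_univ i, hi.symm⟩⟩

/-- The leading position of a vector: the rightmost position of maximal degree. -/
def leadingPosition (v : Fin (ℓ + 1) → SkewPolynomial F) : Fin (ℓ + 1) :=
  (Finset.univ.filter fun i => degree (v i) = vecDegree v).max' (leadingPositions_nonempty v)

end Vectors

/-! ### The shift register problem and the demand-driven algorithm -/

/-- An instance `(s_i, g_i, γ_i)` of the multi-sequence generalised linear skew-feedback shift
register problem.  The index `i = 1, …, ℓ` is `i : Fin ℓ` (from `0`) here; `γ` has the additional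
index `0`, so the shift belonging to `s i` and `g i` is `γ i.succ`. -/
structure MgLSSR (F : Type*) [Field F] (ℓ : ℕ) where
  s : Fin ℓ → SkewPolynomial F
  g : Fin ℓ → SkewPolynomial F
  γ : Fin (ℓ + 1) → ℕ

/-- The variables of the demand-driven algorithm at the head of its loop:
`λ_0, …, λ_ℓ`, `α_1, …, α_ℓ`, `η_1, …, η_ℓ`, `η` (here `etaCur`) and `h`. -/
structure DDState (F : Type*) [Field F] (ℓ : ℕ) where
  lam : Fin (ℓ + 1) → SkewPolynomial F
  alpha : Fin ℓ → F
  eta : Fin ℓ → ℤ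
  etaCur : ℤ
  h : Fin ℓ

/-- `(η, h) ← (η, h - 1)` if `h > 1`, else `(η - 1, ℓ)`; here `h` counts from `0`. -/
def DDState.advance {F : Type*} [Field F] {ℓ : ℕ} (σ : DDState F ℓ) : DDState F ℓ :=
  if 0 < σ.h.val then
    { σ with h := ⟨σ.h.val - 1, by have := σ.h.isLt; omega⟩ }
  else
    { σ with etaCur := σ.etaCur - 1, h := ⟨ℓ - 1, by have := σ.h.isLt; omega⟩ }

/-- The condition `deg λ_0 ≤ η` of the while loop (true if `λ_0 = 0`). -/
def DDState.Continues {F : Type*} [Field F] {ℓ : ℕ} (σ : DDState F ℓ) : Prop :=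
  ∀ n ∈ (σ.lam 0).support, (n : ℤ) ≤ σ.etaCur

namespace MgLSSR

variable {F : Type*} [Field F] {ℓ : ℕ}

/-- `μ = max_i (γ_i + deg g_i)`. -/
def mu (I : MgLSSR F ℓ) : ℕ := Finset.univ.sup fun i : Fin ℓ => I.γ i.succ + natDegree (I.g i)

variable [MulSemiringAction (Multiplicative ℕ) F]

/-- `s_i x^{γ_i}`. -/
def sTilde (I : MgLSSR F ℓ) (i : Fin ℓ) : SkewPolynomial F := I.s i * X ^ I.γ i.succ

/-- `g_i x^{γ_i}`. -/
def gTilde (I : MgLSSR F ℓ) (i : Fin ℓ) : SkewPolynomial F := I.g i * X ^ I.γ i.succ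

/-- The vector `(x^{γ_0}, s_1 x^{γ_1}, …, s_ℓ x^{γ_ℓ})`. -/
def firstRow (I : MgLSSR F ℓ) : Fin (ℓ + 1) → SkewPolynomial F := Fin.cons (X ^ I.γ 0) I.sTilde

/-- The state in which the loop is entered; `none` if the leading position of the first row is
`0`, in which case the algorithm stops at once. -/
def init (I : MgLSSR F ℓ) : Option (DDState F ℓ) :=
  Fin.cases none
    (fun h => some
      { lam := Fin.cons (X ^ I.γ 0) fun _ => 0
        alpha := fun j => leadingCoeff (I.gTilde j)
        eta := fun j => natDegree (I.gTilde j)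
        etaCur := ((vecDegree I.firstRow).unbotD 0 : ℕ)
        h := h })
    (leadingPosition I.firstRow)

/-- The coefficient of `x^η` in `(λ_0 x^{-γ_0}) s_h x^{γ_h} mod g_h x^{γ_h}`. -/
def neededCoeff (I : MgLSSR F ℓ) (σ : DDState F ℓ) : F :=
  (rmod (divXPow (σ.lam 0) (I.γ 0) * I.sTilde σ.h) (I.gTilde σ.h)).coeff σ.etaCur.toNat

open Classical in
/-- One pass through the body of the while loop. -/
def step (I : MgLSSR F ℓ) (σ : DDState F ℓ) : DDState F ℓ :=
  let α := I.neededCoeff σ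
  let αh := σ.alpha σ.h
  let η := σ.etaCur
  let ηh := σ.eta σ.h
  let lam0 := σ.lam 0
  let lamh := σ.lam σ.h.succ
  if α = 0 then
    σ.advance
  else if η < ηh then
    -- swap `(λ_0, α, η)` and `(λ_h, α_h, η_h)` and cancel
    DDState.advance
      { lam := Function.update (Function.update σ.lam σ.h.succ lam0) 0
          (lamh - monomial (ηh - η).toNat (αh / φ^[(ηh - η).toNat] α) * lam0)
        alpha := Function.update σ.alpha σ.h α
        eta := Function.update σ.eta σ.h η
        etaCur := ηh
        h := σ.h }
  else
    DDState.advance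
      { σ with
        lam := Function.update σ.lam 0
          (lam0 - monomial (η - ηh).toNat (α / φ^[(η - ηh).toNat] αh) * lamh) }

/-- The vector `(λ_0 x^{-γ_0}, …, λ_ℓ x^{-γ_0})` returned after the loop. -/
def result (I : MgLSSR F ℓ) (σ : DDState F ℓ) : Fin (ℓ + 1) → SkewPolynomial F :=
  fun j => divXPow (σ.lam j) (I.γ 0)

/-- The vector `(1, 0, …, 0)` returned if the loop is not entered. -/
def trivialResult (ℓ : ℕ) : Fin (ℓ + 1) → SkewPolynomial F := Fin.cons 1 fun _ => 0

end MgLSSR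

/-! ### The cost model

Elements of `F` live in registers; they can be read and written only by the instructions below,
and every instruction (also the constants and the tests for zero) costs one operation.  Integers
(degrees, indices, register addresses) are bookkeeping and are not counted.  A program is a tree;
the only information on the contents of registers that it can act upon is the outcome of the tests
for zero that it has paid for. -/

/-- Addresses of registers: two for each pair `(j, n)`, holding the `n`-th coefficients of the
inputs `s_j` and `g_j`, and a working memory. -/
inductive Addr where
  | inS (j n : ℕ)
  | inG (j n : ℕ)
  | work (n : ℕ)

/-- Programs that end with a value in `β`.  The first argument of the instructions that write a
register is the address of the result. -/
inductive Prog (β : Type) : Type where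
  | done (b : β)
  | zero (dst : Addr) (k : Prog β)
  | one (dst : Addr) (k : Prog β)
  | add (dst x y : Addr) (k : Prog β)
  | sub (dst x y : Addr) (k : Prog β)
  | mul (dst x y : Addr) (k : Prog β)
  | div (dst x y : Addr) (k : Prog β)
  /-- `dst ← θ^i(x)` -/
  | theta (dst : Addr) (i : ℕ) (x : Addr) (k : Prog β)
  /-- continue with `k₁` if `x` holds `0` and with `k₂` otherwise -/
  | ifZero (x : Addr) (k₁ k₂ : Prog β)

section Machine

variable {F : Type*} [Field F] [MulSemiringAction (Multiplicative ℕ) F] {β : Type}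

open Classical in
/-- Executing a program on a memory: the value with which it ends, the memory at the end, and the
number of executed instructions. -/
def Prog.run : Prog β → (Addr → F) → β × (Addr → F) × ℕ
  | .done b, m => (b, m, 0)
  | .zero dst k, m => tick (k.run (Function.update m dst 0))
  | .one dst k, m => tick (k.run (Function.update m dst 1))
  | .add dst x y k, m => tick (k.run (Function.update m dst (m x + m y)))
  | .sub dst x y k, m => tick (k.run (Function.update m dst (m x - m y)))
  | .mul dst x y k, m => tick (k.run (Function.update m dst (m x * m y)))
  | .div dst x y k, m => tick (k.run (Function.update m dst (m x / m y)))
  | .theta dst i x k, m => tick (k.run (Function.update m dst (φ^[i] (m x))))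
  | .ifZero x k₁ k₂, m => if m x = 0 then tick (k₁.run m) else tick (k₂.run m)
where
  /-- count one more instruction -/
  tick (r : β × (Addr → F) × ℕ) : β × (Addr → F) × ℕ := (r.1, r.2.1, r.2.2 + 1)

end Machine

/-- The list `L` of addresses stores `p`: its `n`-th member holds the coefficient of `x^n`, and the
coefficients beyond the end of the list are zero. -/
def Stores {F : Type*} [Field F] (m : Addr → F) (L : List Addr) (p : SkewPolynomial F) : Prop :=
  ∀ n, p.coeff n = (L[n]?).elim 0 m

/-- Where the variables of the algorithm are kept: the integer variables are stored as they are,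
the variables over `F` by addresses. -/
structure Layout (ℓ : ℕ) where
  lam : Fin (ℓ + 1) → List Addr
  alpha : Fin ℓ → Addr
  eta : Fin ℓ → ℤ
  etaCur : ℤ
  h : Fin ℓ

/-- The memory `m`, read according to `L`, holds the state `σ`. -/
structure Layout.Represents {F : Type*} [Field F] {ℓ : ℕ} (L : Layout ℓ) (m : Addr → F)
    (σ : DDState F ℓ) : Prop where
  lam : ∀ j, Stores m (L.lam j) (σ.lam j)
  alpha : ∀ j, m (L.alpha j) = σ.alpha j
  eta : L.eta = σ.eta
  etaCur : L.etaCur = σ.etaCur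
  h : L.h = σ.h

/-- The memory at the beginning: the coefficients of the `s_j` and `g_j` in the input registers,
and `0` elsewhere. -/
def MgLSSR.inputMemory {F : Type*} [Field F] {ℓ : ℕ} (I : MgLSSR F ℓ) : Addr → F
  | .inS j n => if h : j < ℓ then (I.s ⟨j, h⟩).coeff n else 0
  | .inG j n => if h : j < ℓ then (I.g ⟨j, h⟩).coeff n else 0
  | .work _ => 0

/-- Candidates for a realisation of the demand-driven algorithm: programs for what happens before
the loop, for the loop condition, for the loop body and for what happens after the loop.  They may
depend on the integers `ℓ`, `γ_0, …, γ_ℓ` and `d_j = deg g_j` that are part of the input, but not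
on `F`, on `θ` or on the coefficients of the input.  The initial program decides whether the loop
is entered; outputs are vectors of polynomials, given by addresses. -/
structure Realisation where
  start : (ℓ : ℕ) → (γ : Fin (ℓ + 1) → ℕ) → (d : Fin ℓ → ℕ) →
    Prog ((Fin (ℓ + 1) → List Addr) ⊕ Layout ℓ)
  guard : (ℓ : ℕ) → (γ : Fin (ℓ + 1) → ℕ) → (d : Fin ℓ → ℕ) → Layout ℓ → Prog Bool
  body : (ℓ : ℕ) → (γ : Fin (ℓ + 1) → ℕ) → (d : Fin ℓ → ℕ) → Layout ℓ → Prog (Layout ℓ)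
  finish : (ℓ : ℕ) → (γ : Fin (ℓ + 1) → ℕ) → (d : Fin ℓ → ℕ) → Layout ℓ →
    Prog (Fin (ℓ + 1) → List Addr)

section Realise

variable {F : Type*} [Field F] [MulSemiringAction (Multiplicative ℕ) F] {ℓ : ℕ}

/-- `P.Follows I σ L m c`: started at the head of the loop with a memory `m` that holds the state
`σ` of the algorithm according to `L`, the realisation `P` goes through the same passes of the loop
as the algorithm, holds the state of the algorithm after each pass, stops when the algorithm stops,
with the result of the algorithm as its output, and executes `c` instructions. -/
inductive Realisation.Follows (P : Realisation) (I : MgLSSR F ℓ) :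
    DDState F ℓ → Layout ℓ → (Addr → F) → ℕ → Prop where
  | exit {σ : DDState F ℓ} {L : Layout ℓ} {m m₁ m₂ : Addr → F} {c₁ c₂ : ℕ}
      {out : Fin (ℓ + 1) → List Addr} :
      L.Represents m σ →
      ¬ σ.Continues →
      (P.guard ℓ I.γ (fun i => natDegree (I.g i)) L).run m = (false, m₁, c₁) →
      (P.finish ℓ I.γ (fun i => natDegree (I.g i)) L).run m₁ = (out, m₂, c₂) →
      (∀ j, Stores m₂ (out j) (I.result σ j)) →
      P.Follows I σ L m (c₁ + c₂)
  | pass {σ : DDState F ℓ} {L L' : Layout ℓ} {m m₁ m₂ : Addr → F} {c₁ c₂ c : ℕ} :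
      L.Represents m σ →
      σ.Continues →
      (P.guard ℓ I.γ (fun i => natDegree (I.g i)) L).run m = (true, m₁, c₁) →
      (P.body ℓ I.γ (fun i => natDegree (I.g i)) L).run m₁ = (L', m₂, c₂) →
      P.Follows I (I.step σ) L' m₂ c →
      P.Follows I σ L m (c₁ + c₂ + c)

/-- On the instance `I`, the realisation `P` executes the demand-driven algorithm to its end, with
`c` instructions altogether. -/
def Realisation.Realises (P : Realisation) (I : MgLSSR F ℓ) (c : ℕ) : Prop :=
  match I.init with
  | none => ∃ out m,
      (P.start ℓ I.γ fun i => natDegree (I.g i)).run I.inputMemory = (Sum.inl out, m, c) ∧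
      ∀ j, Stores m (out j) (MgLSSR.trivialResult ℓ j)
  | some σ => ∃ L m c₁ c₂,
      (P.start ℓ I.γ fun i => natDegree (I.g i)).run I.inputMemory = (Sum.inr L, m, c₁) ∧
      P.Follows I σ L m c₂ ∧ c = c₁ + c₂

end Realise

end SkewRowReduction

end

namespace SkewRowReduction

/-! ### Coefficients and degrees of skew polynomials -/

section Polynomials

variable {F : Type*} [Field F]

/-! The bound is a product: there are O(ℓμ) passes of the loop, and each pass can be executed with
O(μ) operations.

Passes. Let δ = deg λ_0. Throughout, deg λ_j − η_j ≤ δ − η, with strict inequality for the current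
index h and for those that the sweep at the current η has still to reach. Strictness at h means that
the row operation with λ_h never cancels the dominating term: without a swap δ is unchanged, and
with a swap both δ and η grow by η_h − η. So ℓ(η − δ) + h + 1 is not affected by row operations and
drops by exactly one when the position advances (`Invariant.swap`, `Invariant.cancel`,
`Invariant.advance`, `rank_nextPos`). The loop stops by the time this number is 0, and it starts at
no more than 2ℓμ. The invariant also keeps all λ_j of degree at most μ and makes δ an integer that
is known without inspecting coefficients, so that the loop condition costs nothing.

Cost of a pass. A row operation on polynomials of degree at most μ is clearly O(μ). The needed
coefficient is where the binomials matter. If f x^γ = r + e (x^d + a) x^γ with deg r < d + γ, then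
remainder and quotient merge into one sequence V with f_k = V_k + V_{k+d} θ^k(a), whose first d
terms are the coefficients of r from x^γ on (`coeff_rmod_binomial`). One term is found by running
this recursion downwards along k, k + d, k + 2d, … from an index beyond the degree of f: about μ/d
steps. Each step needs one coefficient of f = (λ_0 x^{-γ_0}) s_h, a sum of at most d + 1 products
because deg s_h ≤ d. Altogether this is again O(μ) (`length_neededCode`).

The remainder of the argument shows that explicit register code computes these quantities and
disturbs nothing else. -/

lemma degree_lt_iff (p : SkewPolynomial F) (D : ℕ) :
    degree p < (D : WithBot ℕ) ↔ ∀ n, D ≤ n → p.coeff n = 0 := by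
  rw [degree, Nat.cast_withBot, Finset.max_eq_sup_withBot, Finset.sup_lt_iff (WithBot.bot_lt_coe D)]
  constructor
  · intro h n hn
    by_contra hne
    have := h n (mem_support_iff.2 hne)
    exact absurd (WithBot.coe_lt_coe.1 this) (by omega)
  · intro h n hn
    by_contra hlt
    refine mem_support_iff.1 hn (h n ?_)
    by_contra hc
    exact hlt (WithBot.coe_lt_coe.2 (by omega))

lemma degree_eq_coe {p : SkewPolynomial F} {D : ℕ} (h : p.coeff D ≠ 0)
    (h' : ∀ n, D < n → p.coeff n = 0) : degree p = (D : WithBot ℕ) := by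
  refine le_antisymm ?_ ?_
  · refine Order.le_of_lt_succ ?_
    exact (degree_lt_iff p (D + 1)).2 fun n hn => h' n hn
  · by_contra hlt
    exact h ((degree_lt_iff p D).1 (not_le.1 hlt) D le_rfl)

lemma natDegree_eq {p : SkewPolynomial F} {D : ℕ} (h : p.coeff D ≠ 0)
    (h' : ∀ n, D < n → p.coeff n = 0) : natDegree p = D := by
  refine le_antisymm (Finset.sup_le fun n hn => ?_)
    (Finset.le_sup (f := id) (mem_support_iff.2 h))
  by_contra hlt
  exact mem_support_iff.1 hn (h' n (not_le.1 hlt))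

lemma degree_zero : degree (0 : SkewPolynomial F) = ⊥ := by
  simp [degree]

lemma degree_eq_bot_iff (p : SkewPolynomial F) : degree p = ⊥ ↔ ∀ n, p.coeff n = 0 := by
  rw [degree, Finset.max_eq_bot, support_eq_empty]
  exact ⟨fun h n => by rw [h, coeff_zero], fun h => SkewPolynomial.ext fun n => h n⟩

lemma coeff_divXPow (p : SkewPolynomial F) (k n : ℕ) :
    (divXPow p k).coeff n = p.coeff (n + k) := by
  unfold divXPow
  induction p using SkewPolynomial.induction with
  | h0 => simp
  | ha m r q _ _ ih =>
    rw [sum_add_index _ _ _ (by simp) (by intros; split_ifs <;> simp), coeff_add, ih, coeff_add,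
      sum_monomial_index (by simp), coeff_monomial]
    congr 1
    split_ifs <;> simp only [coeff_monomial, coeff_zero] <;> try rw [if_neg (by omega)]
    · rw [if_pos (by omega)]
    · omega

variable [MulSemiringAction (Multiplicative ℕ) F]

lemma iterate_φ_ne_zero (i : ℕ) {x : F} (hx : x ≠ 0) : φ^[i] x ≠ 0 := fun h =>
  hx ((φ (R := F)).injective.iterate i (by rw [h, iterate_map_zero]))

lemma coeff_monomial_mul (k : ℕ) (c : F) (b : SkewPolynomial F) (n : ℕ) :
    (monomial k c * b).coeff n = if k ≤ n then c * φ^[k] (b.coeff (n - k)) else 0 := by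
  by_cases hc : c = 0
  · simp [hc]
  · rw [coeff_mul_eq, support_monomial _ hc, Finset.sum_singleton, coeff_monomial, if_pos rfl]

lemma coeff_mul_monomial (p : SkewPolynomial F) (m : ℕ) (c : F) (n : ℕ) :
    (p * monomial m c).coeff n = if m ≤ n then p.coeff (n - m) * φ^[n - m] c else 0 := by
  rw [coeff_mul_eq]
  split_ifs with h
  · rw [Finset.sum_eq_single (n - m)]
    · rw [if_pos (by omega), coeff_monomial, if_pos (by omega)]
    · intro i _ hi
      split_ifs with hin
      · rw [coeff_monomial, if_neg (by omega), iterate_map_zero, mul_zero]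
      · rfl
    · intro hi
      rw [notMem_support_iff.1 hi, zero_mul, ite_self]
  · refine Finset.sum_eq_zero fun i _ => ?_
    split_ifs with hin
    · rw [coeff_monomial, if_neg (by omega), iterate_map_zero, mul_zero]
    · rfl

lemma coeff_mul_X_pow (p : SkewPolynomial F) (m n : ℕ) :
    (p * X ^ m).coeff n = if m ≤ n then p.coeff (n - m) else 0 := by
  rw [X_pow_eq_monomial, coeff_mul_monomial]
  simp

lemma coeff_X_pow (m n : ℕ) : (X ^ m : SkewPolynomial F).coeff n = if m = n then 1 else 0 := by
  rw [X_pow_eq_monomial, coeff_monomial]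

lemma coeff_mul_C (p : SkewPolynomial F) (c : F) (n : ℕ) :
    (p * C c).coeff n = p.coeff n * φ^[n] c := by
  rw [← monomial_zero_left, coeff_mul_monomial]
  simp

lemma degree_X_pow (m : ℕ) : degree (X ^ m : SkewPolynomial F) = (m : WithBot ℕ) :=
  degree_eq_coe (by simp [coeff_X_pow]) fun n hn => by rw [coeff_X_pow, if_neg (by omega)]

/-- The coefficients of a product, as sums over the coefficients of the right factor. -/
lemma coeff_mul_eq_sum_range (p b : SkewPolynomial F) {D : ℕ} (hb : ∀ n, D < n → b.coeff n = 0)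
    (k : ℕ) :
    (p * b).coeff k =
      ∑ r ∈ Finset.range (D + 1), if r ≤ k then p.coeff (k - r) * φ^[k - r] (b.coeff r) else 0 := by
  have hsum : ∀ E, (∀ n, E < n → b.coeff n = 0) →
      b = ∑ r ∈ Finset.range (E + 1), monomial r (b.coeff r) := by
    intro E hE
    conv_lhs => rw [← sum_monomial b, sum_def]
    refine Finset.sum_subset (fun r hr => ?_) fun r _ hr => ?_
    · by_contra hlt
      exact mem_support_iff.1 hr (hE r (by simpa using hlt))
    · rw [notMem_support_iff.1 hr, monomial_zero_right]
  have hcoeff : ∀ (t : Finset ℕ) (f : ℕ → SkewPolynomial F),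
      (∑ i ∈ t, f i).coeff k = ∑ i ∈ t, (f i).coeff k := by
    intro t f
    induction t using Finset.cons_induction with
    | empty => simp
    | cons i t hi ih => rw [Finset.sum_cons, Finset.sum_cons, coeff_add, ih]
  conv_lhs => rw [hsum D hb, Finset.mul_sum, hcoeff]
  exact Finset.sum_congr rfl fun r _ => coeff_mul_monomial _ _ _ _

lemma degree_mul_X_pow (p : SkewPolynomial F) (m : ℕ) :
    degree (p * X ^ m) = degree p + (m : WithBot ℕ) := by
  by_cases hp : p = 0
  · simp [hp, degree_zero]
  · obtain ⟨D, hD⟩ := Finset.max_of_nonempty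
      (Finset.nonempty_iff_ne_empty.2 (by simpa using hp) : p.support.Nonempty)
    have h1 : p.coeff D ≠ 0 := mem_support_iff.1 (Finset.mem_of_max hD)
    have h2 : ∀ n, D < n → p.coeff n = 0 := fun n hn => by
      by_contra h
      exact absurd (Finset.le_max_of_eq (mem_support_iff.2 h) hD) (by omega)
    rw [degree_eq_coe h1 h2, degree_eq_coe (D := D + m)]
    · rfl
    · simpa [coeff_mul_X_pow] using h1
    · intro n hn
      rw [coeff_mul_X_pow, if_pos (by omega), h2 _ (by omega)]

/-! #### Reduction modulo a binomial -/

lemma coeff_X_pow_add_C {d : ℕ} (hd : 0 < d) (a : F) (n : ℕ) :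
    (X ^ d + C a : SkewPolynomial F).coeff n = if n = d then 1 else if n = 0 then a else 0 := by
  rw [coeff_add, coeff_X_pow, coeff_C]
  rcases Nat.lt_trichotomy n d with h | h | h
  · simp [h.ne, h.ne']
  · subst h; simp [hd.ne']
  · have : n ≠ 0 := by omega
    simp [h.ne, h.ne', this]

lemma degree_X_pow_add_C {d : ℕ} (hd : 0 < d) (a : F) :
    degree (X ^ d + C a : SkewPolynomial F) = (d : WithBot ℕ) :=
  degree_eq_coe (by simp [coeff_X_pow_add_C hd]) fun n hn => by
    rw [coeff_X_pow_add_C hd, if_neg (by omega), if_neg (by omega)]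

lemma natDegree_X_pow_add_C {d : ℕ} (hd : 0 < d) (a : F) :
    natDegree (X ^ d + C a : SkewPolynomial F) = d :=
  natDegree_eq (by simp [coeff_X_pow_add_C hd]) fun n hn => by
    rw [coeff_X_pow_add_C hd, if_neg (by omega), if_neg (by omega)]

/-- Horner's scheme for a coefficient of the remainder of `p` modulo `x^d + a`. -/
def hornerCoeff (p : ℕ → F) (a : F) (d : ℕ) : ℕ → ℕ → F
  | 0, _ => 0
  | q + 1, k => p k - hornerCoeff p a d q (k + d) * φ^[k] a

/-- Any solution V of the recursion is determined along k, k + d, k + 2d, … once it vanishes at one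
of these indices, which is where Horner's scheme starts with the value 0. -/
lemma hornerCoeff_eq {p V : ℕ → F} {a : F} {d : ℕ}
    (hV : ∀ k, p k = V k + V (k + d) * φ^[k] a) :
    ∀ q k, V (k + q * d) = 0 → hornerCoeff p a d q k = V k
  | 0, k, h => by simpa [hornerCoeff] using h.symm
  | q + 1, k, h => by
    rw [hornerCoeff, hornerCoeff_eq hV q (k + d) (by rw [← h]; congr 1; ring), hV k]
    ring

/-- The coefficients of the remainder of `f x^γ` modulo `(x^d + a) x^γ`. -/
lemma coeff_rmod_binomial (f : SkewPolynomial F) {d : ℕ} (hd : 0 < d) (a : F) (γ q E : ℕ)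
    (hE : ∀ n, E ≤ n → f.coeff n = 0) (hq : E ≤ q * d) (η : ℕ) :
    (rmod (f * X ^ γ) ((X ^ d + C a) * X ^ γ)).coeff η =
      if γ ≤ η ∧ η < γ + d then hornerCoeff f.coeff a d q (η - γ) else 0 := by
  have hdeg : degree ((X ^ d + C a : SkewPolynomial F) * X ^ γ) = ((d + γ : ℕ) : WithBot ℕ) := by
    rw [degree_mul_X_pow, degree_X_pow_add_C hd]; rfl
  have hg : (X ^ d + C a : SkewPolynomial F) * X ^ γ ≠ 0 := fun h => by
    rw [h, degree_zero] at hdeg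
    exact absurd hdeg (WithBot.bot_ne_coe)
  obtain ⟨hr, e, he⟩ : degree (rmod (f * X ^ γ) ((X ^ d + C a) * X ^ γ)) <
      degree ((X ^ d + C a : SkewPolynomial F) * X ^ γ) ∧
      ∃ e, f * X ^ γ = rmod (f * X ^ γ) ((X ^ d + C a) * X ^ γ) + e * ((X ^ d + C a) * X ^ γ) :=
    Classical.epsilon_spec
      (p := fun r => degree r < degree ((X ^ d + C a : SkewPolynomial F) * X ^ γ) ∧
        ∃ e, f * X ^ γ = r + e * ((X ^ d + C a) * X ^ γ))
      (existsUnique_rmod _ _ hg).exists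
  generalize rmod (f * X ^ γ) ((X ^ d + C a) * X ^ γ) = r at hr he
  rw [hdeg, degree_lt_iff] at hr
  have hc : ∀ n, (f * X ^ γ).coeff n = r.coeff n + (e * ((X ^ d + C a) * X ^ γ)).coeff n :=
    fun n => by conv_lhs => rw [he]
                rw [coeff_add]
  simp only [← mul_assoc, coeff_mul_X_pow] at hc
  split_ifs with hη
  swap
  -- Below x^γ the remainder vanishes because both the dividend and the multiple of the modulus are
  -- right multiples of x^γ; from x^(γ+d) on it vanishes by its degree.
  · rcases not_and_or.1 hη with h | h
    · simpa [h] using (hc η).symm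
    · exact hr η (by omega)
  obtain ⟨k, rfl⟩ : ∃ k, η = γ + k := ⟨η - γ, by omega⟩
  have hk : k < d := by omega
  -- Remainder and quotient do not overlap: r fills the indices below d, and e, shifted by d, fills
  -- the others. Hence V (k + d) is the k-th coefficient of e.
  let V : ℕ → F := fun k => r.coeff (γ + k) + if d ≤ k then e.coeff (k - d) else 0
  have hV : ∀ k, f.coeff k = V k + V (k + d) * φ^[k] a := by
    intro k
    have := hc (γ + k)
    simp only [Nat.le_add_right, if_true, Nat.add_sub_cancel_left, mul_add, coeff_add,
      coeff_mul_X_pow, coeff_mul_C] at this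
    have h0 : r.coeff (γ + (k + d)) = 0 := hr _ (by omega)
    simp only [V, h0, Nat.le_add_left, if_true, Nat.add_sub_cancel, zero_add]
    rw [this]; ring
  -- V vanishes far out, and the recursion pulls this down to E one index at a time: V n = f_n − V
  -- (n + d) θ^n(a), where both terms are 0.
  have hVbig : ∀ N, (∀ n, N ≤ n → V n = 0) → ∀ n, E ≤ n → V n = 0 := by
    intro N
    induction N using Nat.strong_induction_on with
    | _ N ih =>
      intro hN
      rcases Nat.lt_or_ge E N with hEN | hEN
      · refine ih (N - 1) (by omega) fun n hn => ?_
        have := hV n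
        rw [hE n (by omega), hN (n + d) (by omega), zero_mul, add_zero] at this
        exact this.symm
      · exact fun n hn => hN n (by omega)
  have hVfin : ∃ N, ∀ n, N ≤ n → V n = 0 := by
    refine ⟨e.support.sup id + 1 + d, fun n hn => ?_⟩
    have h1 : e.coeff (n - d) = 0 := by
      by_contra h
      have := Finset.le_sup (f := id) (mem_support_iff.2 h)
      simp only [id] at this
      omega
    simp only [V]
    rw [hr _ (by omega), h1, ite_self, add_zero]
  obtain ⟨N, hN⟩ := hVfin
  rw [Nat.add_sub_cancel_left, hornerCoeff_eq hV q k (hVbig N hN _ (by omega))]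
  simp [V, hk.not_ge]

end Polynomials

end SkewRowReduction

namespace SkewRowReduction

/-! ### Straight-line code -/

/-- The instructions that write a register. -/
inductive Instr where
  | zero (dst : Addr)
  | one (dst : Addr)
  | add (dst x y : Addr)
  | sub (dst x y : Addr)
  | mul (dst x y : Addr)
  | div (dst x y : Addr)
  | theta (dst : Addr) (i : ℕ) (x : Addr)

namespace Instr

/-- The program that executes an instruction and goes on with `k`. -/
def prog {β : Type} : Instr → Prog β → Prog β
  | .zero dst, k => .zero dst k
  | .one dst, k => .one dst k
  | .add dst x y, k => .add dst x y k
  | .sub dst x y, k => .sub dst x y k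
  | .mul dst x y, k => .mul dst x y k
  | .div dst x y, k => .div dst x y k
  | .theta dst i x, k => .theta dst i x k

variable {F : Type*} [Field F] [MulSemiringAction (Multiplicative ℕ) F]

open Classical in
/-- The effect of an instruction on the memory. -/
noncomputable def exec (m : Addr → F) : Instr → Addr → F
  | .zero dst => Function.update m dst 0
  | .one dst => Function.update m dst 1
  | .add dst x y => Function.update m dst (m x + m y)
  | .sub dst x y => Function.update m dst (m x - m y)
  | .mul dst x y => Function.update m dst (m x * m y)
  | .div dst x y => Function.update m dst (m x / m y)
  | .theta dst i x => Function.update m dst (φ^[i] (m x))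

end Instr

/-- The program that executes a list of instructions and goes on with `k`. -/
def Prog.code {β : Type} (l : List Instr) (k : Prog β) : Prog β := l.foldr Instr.prog k

/-- Sequential composition of programs. -/
def Prog.bind {β δ : Type} : Prog β → (β → Prog δ) → Prog δ
  | .done b, f => f b
  | .zero dst k, f => .zero dst (k.bind f)
  | .one dst k, f => .one dst (k.bind f)
  | .add dst x y k, f => .add dst x y (k.bind f)
  | .sub dst x y k, f => .sub dst x y (k.bind f)
  | .mul dst x y k, f => .mul dst x y (k.bind f)
  | .div dst x y k, f => .div dst x y (k.bind f)
  | .theta dst i x k, f => .theta dst i x (k.bind f)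
  | .ifZero x k₁ k₂, f => .ifZero x (k₁.bind f) (k₂.bind f)

section Exec

variable {F : Type*} [Field F] [MulSemiringAction (Multiplicative ℕ) F] {β δ : Type}

/-- The effect of a list of instructions on the memory. -/
noncomputable def execList (l : List Instr) (m : Addr → F) : Addr → F := l.foldl Instr.exec m

@[simp] lemma execList_nil (m : Addr → F) : execList [] m = m := rfl

@[simp] lemma execList_cons (i : Instr) (l : List Instr) (m : Addr → F) :
    execList (i :: l) m = execList l (i.exec m) := rfl

lemma execList_append (l l' : List Instr) (m : Addr → F) :
    execList (l ++ l') m = execList l' (execList l m) := List.foldl_append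

lemma Prog.run_code (l : List Instr) (k : Prog β) (m : Addr → F) :
    (Prog.code l k).run m =
      ((k.run (execList l m)).1, (k.run (execList l m)).2.1,
        (k.run (execList l m)).2.2 + l.length) := by
  induction l generalizing m with
  | nil => rfl
  | cons i l ih =>
    have h : (Prog.code (i :: l) k).run m = Prog.run.tick ((Prog.code l k).run (i.exec m)) := by
      cases i <;> rfl
    rw [h, ih]
    rfl

lemma Prog.run_bind (p : Prog β) (f : β → Prog δ) (m : Addr → F) :
    (p.bind f).run m =
      (((f (p.run m).1).run (p.run m).2.1).1, ((f (p.run m).1).run (p.run m).2.1).2.1,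
        ((f (p.run m).1).run (p.run m).2.1).2.2 + (p.run m).2.2) := by
  induction p generalizing m with
  | done b => rfl
  | ifZero x k₁ k₂ ih₁ ih₂ =>
    simp only [Prog.bind, Prog.run]
    split_ifs
    · rw [ih₁]; rfl
    · rw [ih₂]; rfl
  | _ => simp only [Prog.bind, Prog.run, Prog.run.tick, *]; rfl

end Exec

/-! ### Registers -/

/-- The `n`-th register of the `t`-th block of working memory. -/
def reg (t n : ℕ) : Addr := .work (Nat.pair t n)

@[simp] lemma reg_inj {t n t' n' : ℕ} : reg t n = reg t' n' ↔ t = t' ∧ n = n' := by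
  simp [reg, Nat.pair_eq_pair]

@[simp] lemma inS_ne_reg {j i t n : ℕ} : Addr.inS j i ≠ reg t n := by simp [reg]

@[simp] lemma inG_ne_reg {j i t n : ℕ} : Addr.inG j i ≠ reg t n := by simp [reg]

/-- An accumulator. -/
abbrev accReg : Addr := reg 0 0
/-- Scratch memory. -/
abbrev tmpReg : Addr := reg 0 1
/-- A register that always holds `0`. -/
abbrev zeroReg : Addr := reg 0 2
/-- The factor in an elementary row operation. -/
abbrev factorReg : Addr := reg 0 3
/-- A buffer for a polynomial. -/
abbrev bufReg (n : ℕ) : Addr := reg 1 n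
/-- The register of `α_j`. -/
abbrev alphaReg (j : ℕ) : Addr := reg 2 j
/-- The register of the `n`-th coefficient of `λ_j`. -/
abbrev lamReg (j n : ℕ) : Addr := reg (3 + j) n

/-! ### Code for the needed coefficient -/

/-- Add the coefficient of `x^k` of `(λ_0 x^{-γ}) s_h` to the accumulator, if `deg s_h < D`. -/
def mulCoeffCode (γ h k D : ℕ) : List Instr :=
  (List.range D).flatMap fun r =>
    if r ≤ k then
      [.theta tmpReg (k - r) (.inS h r), .mul tmpReg (lamReg 0 (k - r + γ)) tmpReg,
        .add accReg accReg tmpReg]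
    else []

/-- Horner's scheme for a coefficient of `(λ_0 x^{-γ}) s_h` modulo `x^d + a_h`. -/
def hornerCode (γ h d : ℕ) : ℕ → ℕ → List Instr
  | 0, _ => [.zero accReg]
  | q + 1, k =>
    hornerCode γ h d q (k + d) ++
      ([.theta tmpReg k (.inG h 0), .mul accReg accReg tmpReg, .sub accReg zeroReg accReg] ++
        mulCoeffCode γ h k (d + 1))

/-- The code that computes the needed coefficient. -/
def neededCode (γ₀ γ h d M η : ℕ) : List Instr :=
  if γ ≤ η ∧ η < γ + d then hornerCode γ₀ h d (M / d + 2) (η - γ) else [.zero accReg]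

lemma length_mulCoeffCode (γ h k D : ℕ) : (mulCoeffCode γ h k D).length ≤ 3 * D := by
  induction D with
  | zero => simp [mulCoeffCode]
  | succ D ih =>
    unfold mulCoeffCode at ih ⊢
    rw [List.range_succ, List.flatMap_append, List.length_append, List.flatMap_singleton]
    split_ifs <;> simp only [List.length_cons, List.length_nil] <;> omega

/-- A Horner step has 3 instructions of its own and 3(d + 1) for a coefficient of the product; the
single extra instruction clears the accumulator. -/
lemma length_hornerCode (γ h d : ℕ) :
    ∀ q k, (hornerCode γ h d q k).length ≤ 1 + q * (6 + 3 * d)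
  | 0, _ => by simp [hornerCode]
  | q + 1, k => by
    have h1 := length_hornerCode γ h d q (k + d)
    have h2 := length_mulCoeffCode γ h k (d + 1)
    simp only [hornerCode, List.length_append, List.length_cons, List.length_nil]
    rw [add_mul]
    omega

/-- The decisive cost estimate: about M/d Horner steps of cost O(d) each, so d cancels. With d ≥ 1 a
step costs at most 9d, which gives 1 + 9M + 18d ≤ 28M. -/
lemma length_neededCode (γ₀ γ h d M η : ℕ) (hd : 0 < d) (hdM : d ≤ M) :
    (neededCode γ₀ γ h d M η).length ≤ 28 * M := by
  unfold neededCode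
  split_ifs
  · refine (length_hornerCode _ _ _ _ _).trans ?_
    have h1 := Nat.div_mul_le_self M d
    have h2 : (M / d + 2) * (6 + 3 * d) ≤ (M / d + 2) * (9 * d) :=
      Nat.mul_le_mul_left _ (by omega)
    have h3 : (M / d + 2) * (9 * d) = 9 * (M / d * d) + 18 * d := by ring
    omega
  · simp only [List.length_cons, List.length_nil]
    omega

/-! ### Correctness of the code for the needed coefficient. -/

section Specs

variable {F : Type*} [Field F] [MulSemiringAction (Multiplicative ℕ) F]

lemma exec_mulCoeffCode (γ h k D : ℕ) (m : Addr → F) :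
    execList (mulCoeffCode γ h k D) m accReg = m accReg +
        ∑ r ∈ Finset.range D,
          (if r ≤ k then m (lamReg 0 (k - r + γ)) * φ^[k - r] (m (.inS h r)) else 0) ∧
      ∀ x, x ≠ accReg → x ≠ tmpReg → execList (mulCoeffCode γ h k D) m x = m x := by
  induction D with
  | zero => simp [mulCoeffCode]
  | succ D ih =>
    have hsplit : mulCoeffCode γ h k (D + 1) = mulCoeffCode γ h k D ++
        if D ≤ k then
          [.theta tmpReg (k - D) (.inS h D), .mul tmpReg (lamReg 0 (k - D + γ)) tmpReg,
            .add accReg accReg tmpReg]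
        else [] := by
      simp [mulCoeffCode, List.range_succ]
    rw [hsplit, execList_append, Finset.sum_range_succ]
    generalize execList (mulCoeffCode γ h k D) m = m' at ih
    obtain ⟨h1, h2⟩ := ih
    have h3 := h2 (.inS h D) (by simp) (by simp)
    have h4 := h2 (lamReg 0 (k - D + γ)) (by simp) (by simp)
    split_ifs
    · constructor
      · simp [Instr.exec, h1, h3, h4, add_assoc]
      · intro x hx hx'
        simp [Instr.exec, hx, hx', h2 x hx hx']
    · simpa using ⟨h1, h2⟩

/-- The code recurses into k + d before it treats k, so the accumulator already holds the inner
Horner value. Only the accumulator and the scratch register change, so each step can read the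
original operands. -/
lemma exec_hornerCode (γ h d : ℕ) (m : Addr → F) (lam s : SkewPolynomial F) (a : F)
    (hZ : m zeroReg = 0) (ha : m (.inG h 0) = a) (hs : ∀ n, m (.inS h n) = s.coeff n)
    (hlam : ∀ n, m (lamReg 0 n) = lam.coeff n) (hsd : ∀ n, d < n → s.coeff n = 0) :
    ∀ q k, execList (hornerCode γ h d q k) m accReg =
        hornerCoeff (divXPow lam γ * s).coeff a d q k ∧
      ∀ x, x ≠ accReg → x ≠ tmpReg → execList (hornerCode γ h d q k) m x = m x
  | 0, k => by
    constructor
    · simp [hornerCode, hornerCoeff, Instr.exec]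
    · intro x hx _
      simp [hornerCode, Instr.exec, hx]
  | q + 1, k => by
    have ih := exec_hornerCode γ h d m lam s a hZ ha hs hlam hsd q (k + d)
    rw [hornerCode, execList_append, execList_append]
    generalize execList (hornerCode γ h d q (k + d)) m = m₁ at ih
    obtain ⟨h1, h2⟩ := ih
    have h3 : execList [.theta tmpReg k (.inG h 0), .mul accReg accReg tmpReg,
        .sub accReg zeroReg accReg] m₁ accReg =
        -(hornerCoeff (divXPow lam γ * s).coeff a d q (k + d) * φ^[k] a) := by
      simp [Instr.exec, h1, h2 zeroReg (by simp) (by simp), hZ,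
        h2 (.inG h 0) (by simp) (by simp), ha]
    have h4 : ∀ x, x ≠ accReg → x ≠ tmpReg → execList [.theta tmpReg k (.inG h 0),
        .mul accReg accReg tmpReg, .sub accReg zeroReg accReg] m₁ x = m x := by
      intro x hx hx'
      simp [Instr.exec, hx, hx', h2 x hx hx']
    generalize execList [.theta tmpReg k (.inG h 0), .mul accReg accReg tmpReg,
        .sub accReg zeroReg accReg] m₁ = m₂ at h3 h4
    obtain ⟨h5, h6⟩ := exec_mulCoeffCode γ h k (d + 1) m₂
    refine ⟨?_, fun x hx hx' => (h6 x hx hx').trans (h4 x hx hx')⟩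
    rw [h5, h3, hornerCoeff, coeff_mul_eq_sum_range _ _ hsd, neg_add_eq_sub]
    congr 1
    refine Finset.sum_congr rfl fun r _ => ?_
    rw [h4 (lamReg 0 _) (by simp) (by simp), h4 (.inS h r) (by simp) (by simp), hlam, hs,
      coeff_divXPow]

lemma exec_neededCode (γ₀ γ h d M η : ℕ) (m : Addr → F) (lam s : SkewPolynomial F) (a : F)
    (hZ : m zeroReg = 0) (ha : m (.inG h 0) = a) (hs : ∀ n, m (.inS h n) = s.coeff n)
    (hlam : ∀ n, m (lamReg 0 n) = lam.coeff n) (hsd : ∀ n, d < n → s.coeff n = 0)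
    (hd : 0 < d) (hM : ∀ n, M < n → lam.coeff n = 0) :
    execList (neededCode γ₀ γ h d M η) m accReg =
        (rmod (divXPow lam γ₀ * (s * X ^ γ)) ((X ^ d + C a) * X ^ γ)).coeff η ∧
      ∀ x, x ≠ accReg → x ≠ tmpReg → execList (neededCode γ₀ γ h d M η) m x = m x := by
  -- The product has degree at most M + d, and ⌊M/d⌋ + 2 Horner steps of width d reach beyond that.
  have hE : ∀ n, M + d + 1 ≤ n → (divXPow lam γ₀ * s).coeff n = 0 := by
    intro n hn
    rw [coeff_mul_eq_sum_range _ _ hsd]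
    refine Finset.sum_eq_zero fun r hr => ?_
    have := Finset.mem_range.1 hr
    rw [if_pos (by omega), coeff_divXPow, hM _ (by omega), zero_mul]
  have hq : M + d + 1 ≤ (M / d + 2) * d := by
    have h1 := Nat.div_add_mod M d
    have h2 := Nat.mod_lt M hd
    have h3 : (M / d + 2) * d = d * (M / d) + 2 * d := by ring
    omega
  rw [← mul_assoc, coeff_rmod_binomial _ hd a γ _ _ hE hq]
  unfold neededCode
  split_ifs
  · exact exec_hornerCode γ₀ h d m lam s a hZ ha hs hlam hsd _ _
  · constructor
    · simp [Instr.exec]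
    · intro x hx _
      simp [Instr.exec, hx]

end Specs

/-! ### Code for the elementary row operations -/

/-- Write `p - f x^k q` to the buffer, where `p` and `q` are the polynomials in blocks `t` and `u`
and `f` is the content of the factor register. -/
def combineCode (N k t u : ℕ) : List Instr :=
  (List.range N).flatMap fun n =>
    if k ≤ n then
      [.theta tmpReg k (reg u (n - k)), .mul tmpReg factorReg tmpReg,
        .sub (bufReg n) (reg t n) tmpReg]
    else [.add (bufReg n) (reg t n) zeroReg]

/-- Copy the first `N` registers of block `u` to block `t`. -/
def copyCode (N t u : ℕ) : List Instr :=
  (List.range N).map fun n => .add (reg t n) (reg u n) zeroReg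

/-- The row operation of a pass that swaps. -/
def swapCode (N k h : ℕ) : List Instr :=
  [.theta tmpReg k accReg, .div factorReg (alphaReg h) tmpReg] ++
    -- The new λ_0 goes to the buffer first, since it needs both old polynomials; then the old λ_0
    -- can overwrite λ_h. The register of α_h is overwritten last, after the factor has been formed
    -- from its old value.
    (combineCode N k (3 + (h + 1)) 3 ++ (copyCode N (3 + (h + 1)) 3 ++ (copyCode N 3 1 ++
      [.add (alphaReg h) accReg zeroReg])))

/-- The row operation of a pass that does not swap. -/
def cancelCode (N k h : ℕ) : List Instr :=
  [.theta tmpReg k (alphaReg h), .div factorReg accReg tmpReg] ++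
    (combineCode N k 3 (3 + (h + 1)) ++ copyCode N 3 1)

lemma length_combineCode (N k t u : ℕ) : (combineCode N k t u).length ≤ 3 * N := by
  induction N with
  | zero => simp [combineCode]
  | succ N ih =>
    unfold combineCode at ih ⊢
    rw [List.range_succ, List.flatMap_append, List.length_append, List.flatMap_singleton]
    split_ifs <;> simp only [List.length_cons, List.length_nil] <;> omega

lemma length_copyCode (N t u : ℕ) : (copyCode N t u).length = N := by simp [copyCode]

lemma length_swapCode (N k h : ℕ) : (swapCode N k h).length ≤ 5 * N + 3 := by
  have := length_combineCode N k (3 + (h + 1)) 3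
  simp only [swapCode, List.length_append, length_copyCode, List.length_cons, List.length_nil]
  omega

lemma length_cancelCode (N k h : ℕ) : (cancelCode N k h).length ≤ 4 * N + 2 := by
  have := length_combineCode N k 3 (3 + (h + 1))
  simp only [cancelCode, List.length_append, length_copyCode, List.length_cons, List.length_nil]
  omega

/-! ### Correctness of the code for the row operations. -/

section Specs

variable {F : Type*} [Field F] [MulSemiringAction (Multiplicative ℕ) F]

/-- Blocks from 3 on are disjoint from the scratch registers and from the buffer, so the operands
stay intact while the result is written. -/
lemma exec_combineCode (k t u : ℕ) (ht : 3 ≤ t) (hu : 3 ≤ u) (m : Addr → F)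
    (hZ : m zeroReg = 0) (N : ℕ) :
    (∀ n < N, execList (combineCode N k t u) m (bufReg n) =
        m (reg t n) - if k ≤ n then m factorReg * φ^[k] (m (reg u (n - k))) else 0) ∧
      ∀ x, (∀ n, x ≠ bufReg n) → x ≠ tmpReg → execList (combineCode N k t u) m x = m x := by
  induction N with
  | zero => simp [combineCode]
  | succ N ih =>
    have hsplit : combineCode (N + 1) k t u = combineCode N k t u ++
        if k ≤ N then
          [.theta tmpReg k (reg u (N - k)), .mul tmpReg factorReg tmpReg,
            .sub (bufReg N) (reg t N) tmpReg]
        else [.add (bufReg N) (reg t N) zeroReg] := by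
      simp [combineCode, List.range_succ]
    rw [hsplit, execList_append]
    generalize execList (combineCode N k t u) m = m' at ih
    obtain ⟨h1, h2⟩ := ih
    have ht1 : t ≠ 1 := by omega
    have ht0 : t ≠ 0 := by omega
    have hu1 : u ≠ 1 := by omega
    have hu0 : u ≠ 0 := by omega
    have e1 := h2 (reg t N) (by simp [ht1]) (by simp [ht0])
    have e2 := h2 (reg u (N - k)) (by simp [hu1]) (by simp [hu0])
    have e3 := h2 factorReg (by simp) (by simp)
    have e4 := h2 zeroReg (by simp) (by simp)
    split_ifs with hk
    · constructor
      · intro n hn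
        rcases Nat.lt_succ_iff_lt_or_eq.1 hn with hlt | rfl
        · simp [Instr.exec, Function.update_apply, hlt.ne, h1 n hlt]
        · simp [Instr.exec, hk, ht0, e1, e2, e3]
      · intro x hx hx'
        simp [Instr.exec, Function.update_apply, hx, hx', h2 x hx hx']
    · constructor
      · intro n hn
        rcases Nat.lt_succ_iff_lt_or_eq.1 hn with hlt | rfl
        · simp [Instr.exec, hlt.ne, h1 n hlt]
        · simp [Instr.exec, hk, e1, e4, hZ]
      · intro x hx hx'
        simp [Instr.exec, hx, h2 x hx hx']

/-- Copying is addition of 0; the conditions on t protect the source and the zero register. -/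
lemma exec_copyCode (t u : ℕ) (htu : u ≠ t) (ht : t ≠ 0) (m : Addr → F) (hZ : m zeroReg = 0)
    (N : ℕ) :
    (∀ n < N, execList (copyCode N t u) m (reg t n) = m (reg u n)) ∧
      ∀ x, (∀ n < N, x ≠ reg t n) → execList (copyCode N t u) m x = m x := by
  induction N with
  | zero => simp [copyCode]
  | succ N ih =>
    have hsplit : copyCode (N + 1) t u = copyCode N t u ++
        [.add (reg t N) (reg u N) zeroReg] := by simp [copyCode, List.range_succ]
    rw [hsplit, execList_append]
    generalize execList (copyCode N t u) m = m' at ih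
    obtain ⟨h1, h2⟩ := ih
    have e1 := h2 (reg u N) (by simp [htu])
    have e2 := h2 zeroReg (by simp [ht.symm])
    constructor
    · intro n hn
      rcases Nat.lt_succ_iff_lt_or_eq.1 hn with hlt | rfl
      · simp [Instr.exec, hlt.ne, h1 n hlt]
      · simp [Instr.exec, e1, e2, hZ]
    · intro x hx
      simp [Instr.exec, hx N (by omega),
        h2 x fun n hn => hx n (by omega)]

/-- The registers that serve as scratch memory in a pass of the loop. -/
def IsScratch (x : Addr) : Prop :=
  x = accReg ∨ x = tmpReg ∨ x = factorReg ∨ ∃ n, x = bufReg n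

lemma exec_swapCode (N k h : ℕ) (m : Addr → F) (hZ : m zeroReg = 0) :
    (∀ n < N, execList (swapCode N k h) m (reg 3 n) = m (reg (3 + (h + 1)) n) -
        if k ≤ n then m (alphaReg h) / φ^[k] (m accReg) * φ^[k] (m (reg 3 (n - k))) else 0) ∧
      (∀ n < N, execList (swapCode N k h) m (reg (3 + (h + 1)) n) = m (reg 3 n)) ∧
      execList (swapCode N k h) m (alphaReg h) = m accReg ∧
      ∀ x, ¬ IsScratch x → (∀ n < N, x ≠ reg 3 n) → (∀ n < N, x ≠ reg (3 + (h + 1)) n) →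
        x ≠ alphaReg h → execList (swapCode N k h) m x = m x := by
  rw [swapCode, execList_append, execList_append, execList_append, execList_append]
  have a1 : execList [.theta tmpReg k accReg, .div factorReg (alphaReg h) tmpReg] m factorReg =
      m (alphaReg h) / φ^[k] (m accReg) := by simp [Instr.exec]
  have a2 : ∀ x, x ≠ tmpReg → x ≠ factorReg →
      execList [.theta tmpReg k accReg, .div factorReg (alphaReg h) tmpReg] m x = m x := by
    intro x hx hx'
    simp [Instr.exec, hx, hx']
  generalize execList [.theta tmpReg k accReg, .div factorReg (alphaReg h) tmpReg] m = m₁ at a1 a2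
  obtain ⟨b1, b2⟩ := exec_combineCode k (3 + (h + 1)) 3 (by omega) le_rfl m₁
    (by rw [a2 _ (by simp) (by simp), hZ]) N
  generalize execList (combineCode N k (3 + (h + 1)) 3) m₁ = m₂ at b1 b2
  have b3 : ∀ x, ¬ IsScratch x → m₂ x = m x := by
    intro x hx
    simp only [IsScratch, not_or, not_exists] at hx
    rw [b2 x hx.2.2.2 hx.2.1, a2 x hx.2.1 hx.2.2.1]
  obtain ⟨c1, c2⟩ := exec_copyCode (3 + (h + 1)) 3 (by omega) (by omega) m₂
    (by rw [b3 _ (by simp [IsScratch]), hZ]) N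
  generalize execList (copyCode N (3 + (h + 1)) 3) m₂ = m₃ at c1 c2
  obtain ⟨d1, d2⟩ := exec_copyCode 3 1 (by omega) (by omega) m₃
    (by rw [c2 _ (by simp), b3 _ (by simp [IsScratch]), hZ]) N
  generalize execList (copyCode N 3 1) m₃ = m₄ at d1 d2
  refine ⟨fun n hn => ?_, fun n hn => ?_, ?_, fun x hx hx1 hx2 hx3 => ?_⟩
  · have : execList [.add (alphaReg h) accReg zeroReg] m₄ (reg 3 n) = m₄ (reg 3 n) := by
      simp [Instr.exec]
    rw [this, d1 n hn, c2 _ (by simp; omega), b1 n hn, a1, a2 _ (by simp) (by simp),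
      a2 (reg 3 (n - k)) (by simp) (by simp)]
  · have : execList [.add (alphaReg h) accReg zeroReg] m₄ (reg (3 + (h + 1)) n) =
        m₄ (reg (3 + (h + 1)) n) := by
      have : 3 + (h + 1) ≠ 2 := by omega
      simp [Instr.exec, this]
    rw [this, d2 _ (by simp), c1 n hn, b3 _ (by simp [IsScratch])]
  · have : execList [.add (alphaReg h) accReg zeroReg] m₄ (alphaReg h) =
        m₄ accReg + m₄ zeroReg := by simp [Instr.exec]
    rw [this, d2 _ (by simp), d2 _ (by simp), c2 _ (by simp), c2 _ (by simp),
      b2 _ (by simp) (by simp), a2 _ (by simp) (by simp), b3 _ (by simp [IsScratch]), hZ, add_zero]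
  · have : execList [.add (alphaReg h) accReg zeroReg] m₄ x = m₄ x := by
      simp [Instr.exec, hx3]
    rw [this, d2 x hx1, c2 x hx2, b3 x hx]

lemma exec_cancelCode (N k h : ℕ) (m : Addr → F) (hZ : m zeroReg = 0) :
    (∀ n < N, execList (cancelCode N k h) m (reg 3 n) = m (reg 3 n) -
        if k ≤ n then m accReg / φ^[k] (m (alphaReg h)) * φ^[k] (m (reg (3 + (h + 1)) (n - k)))
        else 0) ∧
      ∀ x, ¬ IsScratch x → (∀ n < N, x ≠ reg 3 n) → execList (cancelCode N k h) m x = m x := by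
  rw [cancelCode, execList_append, execList_append]
  have a1 : execList [.theta tmpReg k (alphaReg h), .div factorReg accReg tmpReg] m factorReg =
      m accReg / φ^[k] (m (alphaReg h)) := by simp [Instr.exec]
  have a2 : ∀ x, x ≠ tmpReg → x ≠ factorReg →
      execList [.theta tmpReg k (alphaReg h), .div factorReg accReg tmpReg] m x = m x := by
    intro x hx hx'
    simp [Instr.exec, hx, hx']
  generalize execList [.theta tmpReg k (alphaReg h), .div factorReg accReg tmpReg] m = m₁ at a1 a2
  obtain ⟨b1, b2⟩ := exec_combineCode k 3 (3 + (h + 1)) le_rfl (by omega) m₁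
    (by rw [a2 _ (by simp) (by simp), hZ]) N
  generalize execList (combineCode N k 3 (3 + (h + 1))) m₁ = m₂ at b1 b2
  have b3 : ∀ x, ¬ IsScratch x → m₂ x = m x := by
    intro x hx
    simp only [IsScratch, not_or, not_exists] at hx
    rw [b2 x hx.2.2.2 hx.2.1, a2 x hx.2.1 hx.2.2.1]
  obtain ⟨d1, d2⟩ := exec_copyCode 3 1 (by omega) (by omega) m₂
    (by rw [b3 _ (by simp [IsScratch]), hZ]) N
  generalize execList (copyCode N 3 1) m₂ = m₃ at d1 d2
  refine ⟨fun n hn => ?_, fun x hx hx1 => ?_⟩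
  · rw [d1 n hn, b1 n hn, a1, a2 _ (by simp) (by simp), a2 (reg (3 + (h + 1)) (n - k)) (by simp)
      (by simp)]
  · rw [d2 x hx1, b3 x hx]

end Specs

end SkewRowReduction

namespace SkewRowReduction

/-! ### An invariant of the algorithm -/

/-- The position that follows `(η, h)`. -/
def nextPos {ℓ : ℕ} (e : ℤ) (h : Fin ℓ) : ℤ × Fin ℓ :=
  if 0 < h.val then (e, ⟨h.val - 1, by have := h.isLt; omega⟩)
  else (e - 1, ⟨ℓ - 1, by have := h.isLt; omega⟩)

section Invariant

variable {F : Type*} [Field F] {ℓ : ℕ}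

lemma DDState.advance_eq (σ : DDState F ℓ) :
    σ.advance = { σ with
      etaCur := (nextPos σ.etaCur σ.h).1, h := (nextPos σ.etaCur σ.h).2 } := by
  unfold DDState.advance nextPos
  split_ifs <;> rfl

/-- The number of passes that are left when `λ_0` has degree `δ`. -/
def rank (δ : ℕ) (e : ℤ) (h : Fin ℓ) : ℤ := ℓ * (e - δ) + h.val + 1

/-- The rank is a base-ℓ count of positions: lowering η by one costs ℓ, and the return of h from the
first index to the last gives back ℓ − 1. -/
lemma rank_nextPos (δ : ℕ) (e : ℤ) (h : Fin ℓ) :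
    rank δ (nextPos e h).1 (nextPos e h).2 = rank δ e h - 1 := by
  have := h.isLt
  unfold rank nextPos
  split_ifs with h0
  · simp only
    push_cast [Nat.cast_sub (show 1 ≤ h.val from h0)]
    ring
  · simp only
    have h1 : h.val = 0 := by omega
    push_cast [Nat.cast_sub (show 1 ≤ ℓ by omega), h1]
    ring

/-- Position `0` of the `0`-th row leads those of the other rows: `λ_0` has degree `δ`, and
`deg λ_j - η_j ≤ δ - η`, strictly for the first `t` indices `j`. -/
structure Invariant (M t : ℕ) (σ : DDState F ℓ) (δ : ℕ) : Prop where
  lead : (σ.lam 0).coeff δ ≠ 0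
  top : ∀ n, δ < n → (σ.lam 0).coeff n = 0
  alpha_ne : ∀ j, σ.alpha j ≠ 0
  eta_le : ∀ j, σ.eta j ≤ M
  cur_le : σ.etaCur ≤ M
  deg_le : δ ≤ M
  lam_le : ∀ j n, (σ.lam (Fin.succ j)).coeff n ≠ 0 → n ≤ M
  small : ∀ j n, (σ.lam (Fin.succ j)).coeff n ≠ 0 → (n : ℤ) - σ.eta j ≤ δ - σ.etaCur
  small_lt : ∀ j n, j.val < t → (σ.lam (Fin.succ j)).coeff n ≠ 0 →
    (n : ℤ) - σ.eta j < δ - σ.etaCur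

variable {M t δ : ℕ} {σ : DDState F ℓ}

lemma Invariant.mono (H : Invariant M t σ δ) {t' : ℕ} (h : t' ≤ t) : Invariant M t' σ δ :=
  { H with small_lt := fun j n hj => H.small_lt j n (by omega) }

lemma Invariant.continues_iff (H : Invariant M t σ δ) : σ.Continues ↔ (δ : ℤ) ≤ σ.etaCur := by
  constructor
  · exact fun h => h δ (mem_support_iff.2 H.lead)
  · intro h n hn
    have : ¬ δ < n := fun hlt => mem_support_iff.1 hn (H.top n hlt)
    omega

/-- Within a sweep the set of strict indices is just what the next position needs. At the end of a
sweep η drops by one, so δ − η grows and every weak inequality becomes strict. -/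
lemma Invariant.advance (H : Invariant M σ.h σ δ) :
    Invariant M (σ.advance.h + 1) σ.advance δ := by
  have hlt := σ.h.isLt
  rw [DDState.advance_eq]
  unfold nextPos
  split_ifs with h0
  · refine ⟨H.lead, H.top, H.alpha_ne, H.eta_le, H.cur_le, H.deg_le, H.lam_le, H.small, ?_⟩
    intro j n hj
    refine H.small_lt j n ?_
    simp only at hj
    omega
  · have := H.cur_le
    refine ⟨H.lead, H.top, H.alpha_ne, H.eta_le, ?_, H.deg_le, H.lam_le, ?_, ?_⟩
    · simp only; omega
    · intro j n hn
      have := H.small j n hn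
      simp only at this ⊢; omega
    · intro j n _ hn
      have := H.small j n hn
      simp only at this ⊢; omega

variable [MulSemiringAction (Multiplicative ℕ) F]

/-- The state after the row operation of a pass that swaps. -/
noncomputable def swapState (σ : DDState F ℓ) (α : F) : DDState F ℓ :=
  { lam := Function.update (Function.update σ.lam σ.h.succ (σ.lam 0)) 0
      (σ.lam σ.h.succ - monomial (σ.eta σ.h - σ.etaCur).toNat
        (σ.alpha σ.h / φ^[(σ.eta σ.h - σ.etaCur).toNat] α) * σ.lam 0)
    alpha := Function.update σ.alpha σ.h α
    eta := Function.update σ.eta σ.h σ.etaCur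
    etaCur := σ.eta σ.h
    h := σ.h }

/-- The state after the row operation of a pass that does not swap. -/
noncomputable def cancelState (σ : DDState F ℓ) (α : F) : DDState F ℓ :=
  { σ with
    lam := Function.update σ.lam 0
      (σ.lam 0 - monomial (σ.etaCur - σ.eta σ.h).toNat
        (α / φ^[(σ.etaCur - σ.eta σ.h).toNat] (σ.alpha σ.h)) * σ.lam σ.h.succ) }

lemma swapState_lam_self (σ : DDState F ℓ) (α : F) :
    (swapState σ α).lam σ.h.succ = σ.lam 0 := by
  simp [swapState]

lemma swapState_lam_of_ne (σ : DDState F ℓ) (α : F) {j : Fin ℓ} (hj : j ≠ σ.h) :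
    (swapState σ α).lam j.succ = σ.lam j.succ := by
  simp [swapState, hj]

lemma cancelState_lam_succ (σ : DDState F ℓ) (α : F) (j : Fin ℓ) :
    (cancelState σ α).lam j.succ = σ.lam j.succ := by
  simp [cancelState]

lemma swapState_coeff (σ : DDState F ℓ) (α : F) (n : ℕ) :
    ((swapState σ α).lam 0).coeff n = (σ.lam σ.h.succ).coeff n -
      if (σ.eta σ.h - σ.etaCur).toNat ≤ n then
        σ.alpha σ.h / φ^[(σ.eta σ.h - σ.etaCur).toNat] α *
          φ^[(σ.eta σ.h - σ.etaCur).toNat] ((σ.lam 0).coeff (n - (σ.eta σ.h - σ.etaCur).toNat))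
      else 0 := by
  simp only [swapState, Function.update_self, coeff_sub, coeff_monomial_mul]

lemma cancelState_coeff (σ : DDState F ℓ) (α : F) (n : ℕ) :
    ((cancelState σ α).lam 0).coeff n = (σ.lam 0).coeff n -
      if (σ.etaCur - σ.eta σ.h).toNat ≤ n then
        α / φ^[(σ.etaCur - σ.eta σ.h).toNat] (σ.alpha σ.h) *
          φ^[(σ.etaCur - σ.eta σ.h).toNat]
            ((σ.lam σ.h.succ).coeff (n - (σ.etaCur - σ.eta σ.h).toNat))
      else 0 := by
  simp only [cancelState, Function.update_self, coeff_sub, coeff_monomial_mul]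

/-- With k = η_h − η, strictness at h says deg λ_h < δ + k, so x^k λ_0 alone supplies the leading
term of the new λ_0. The difference δ − η is unchanged. The old λ_0 attains equality at index h,
which is why strictness survives only below h. The new degree stays at most M since δ + k ≤ η + k =
η_h. -/
lemma Invariant.swap (H : Invariant M (σ.h + 1) σ δ) {α : F} (hα : α ≠ 0)
    (hδ : (δ : ℤ) ≤ σ.etaCur) (hlt : σ.etaCur < σ.eta σ.h) :
    Invariant M σ.h (swapState σ α) (δ + (σ.eta σ.h - σ.etaCur).toNat) := by
  obtain ⟨k, hk⟩ : ∃ k : ℕ, σ.eta σ.h = σ.etaCur + k := ⟨(σ.eta σ.h - σ.etaCur).toNat, by omega⟩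
  have hk' : (σ.eta σ.h - σ.etaCur).toNat = k := by omega
  have hM := H.eta_le σ.h
  have hsmall : ∀ n, (σ.lam σ.h.succ).coeff n ≠ 0 → n < δ + k := by
    intro n hn
    have := H.small_lt σ.h n (by omega) hn
    omega
  have hcur : (swapState σ α).etaCur = σ.etaCur + k := hk
  constructor
  · rw [swapState_coeff, hk', if_pos (by omega), Nat.add_sub_cancel,
      not_ne_iff.1 (mt (hsmall _) (by omega)), zero_sub, neg_ne_zero]
    exact mul_ne_zero (div_ne_zero (H.alpha_ne _) (iterate_φ_ne_zero _ hα))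
      (iterate_φ_ne_zero _ H.lead)
  · intro n hn
    rw [hk'] at hn
    rw [swapState_coeff, hk', not_ne_iff.1 (mt (hsmall _) (by omega)), H.top (n - k) (by omega),
      iterate_map_zero, mul_zero, ite_self, sub_zero]
  · intro j
    simp only [swapState, Function.update_apply]
    split_ifs
    · exact hα
    · exact H.alpha_ne j
  · intro j
    have := H.cur_le
    have := H.eta_le j
    simp only [swapState, Function.update_apply]
    split_ifs <;> assumption
  · exact hM
  · omega
  · intro j n hn
    by_cases hj : j = σ.h
    · rw [hj, swapState_lam_self] at hn
      have := not_lt.1 (mt (H.top n) hn)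
      exact this.trans H.deg_le
    · rw [swapState_lam_of_ne _ _ hj] at hn
      exact H.lam_le j n hn
  · intro j n hn
    rw [hk', hcur]
    by_cases hj : j = σ.h
    · rw [hj, swapState_lam_self] at hn
      have := not_lt.1 (mt (H.top n) hn)
      simp only [hj, swapState, Function.update_self]
      omega
    · rw [swapState_lam_of_ne _ _ hj] at hn
      have := H.small j n hn
      simp only [swapState, Function.update_of_ne hj]
      omega
  · intro j n hjt hn
    have hj : j ≠ σ.h := fun h => by rw [h] at hjt; omega
    rw [swapState_lam_of_ne _ _ hj] at hn
    rw [hk', hcur]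
    have := H.small_lt j n (by omega) hn
    simp only [swapState, Function.update_of_ne hj]
    omega

/-- By strictness at h, x^(η − η_h) λ_h has degree less than δ, so λ_0 changes only below its
leading term, whatever α is. -/
lemma Invariant.cancel (H : Invariant M (σ.h + 1) σ δ) (α : F) (hle : σ.eta σ.h ≤ σ.etaCur) :
    Invariant M σ.h (cancelState σ α) δ := by
  have hz : ∀ n, δ ≤ n → ((cancelState σ α).lam 0).coeff n = (σ.lam 0).coeff n := by
    intro n hn
    rw [cancelState_coeff, sub_eq_self]
    split_ifs
    · have : (σ.lam σ.h.succ).coeff (n - (σ.etaCur - σ.eta σ.h).toNat) = 0 := by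
        by_contra h
        have := H.small_lt σ.h _ (by omega) h
        omega
      rw [this, iterate_map_zero, mul_zero]
    · rfl
  refine ⟨?_, fun n hn => ?_, H.alpha_ne, H.eta_le, H.cur_le, H.deg_le, fun j n hn => ?_,
    fun j n hn => ?_, fun j n hj hn => ?_⟩
  · rw [hz δ le_rfl]; exact H.lead
  · rw [hz n hn.le]; exact H.top n hn
  all_goals rw [cancelState_lam_succ] at hn
  · exact H.lam_le j n hn
  · exact H.small j n hn
  · exact H.small_lt j n (by omega) hn

open Classical in
lemma MgLSSR.step_eq (I : MgLSSR F ℓ) (σ : DDState F ℓ) :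
    I.step σ = if I.neededCoeff σ = 0 then σ.advance
      else if σ.etaCur < σ.eta σ.h then (swapState σ (I.neededCoeff σ)).advance
      else (cancelState σ (I.neededCoeff σ)).advance := rfl

end Invariant

/-! ### The realisation -/

/-- The bound `μ` on the degrees. -/
def maxDegree {ℓ : ℕ} (γ : Fin (ℓ + 1) → ℕ) (d : Fin ℓ → ℕ) : ℕ :=
  Finset.univ.sup fun i : Fin ℓ => γ i.succ + d i

/-- The layout when `λ_0` has degree `δ`. -/
def layoutAt {ℓ : ℕ} (M δ : ℕ) (eta : Fin ℓ → ℤ) (p : ℤ × Fin ℓ) : Layout ℓ where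
  -- The list for λ_0 ends at the leading coefficient, so its length passes δ on to the next pass.
  lam j := (List.range (if j = 0 then δ + 1 else M + 1)).map (lamReg j)
  alpha j := alphaReg j
  eta := eta
  etaCur := p.1
  h := p.2

/-- Determine the degree of `s_j`, if it is at most the second argument. -/
def degreeProg (j : ℕ) : ℕ → Prog (WithBot ℕ)
  | 0 => .ifZero (.inS j 0) (.done ⊥) (.done ((0 : ℕ) : WithBot ℕ))
  | n + 1 => .ifZero (.inS j (n + 1)) (degreeProg j n) (.done ((n + 1 : ℕ) : WithBot ℕ))

/-- Determine the degrees of the `s_j` for the `j` in a list. -/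
def degreesProg {ℓ : ℕ} (d : Fin ℓ → ℕ) :
    List (Fin ℓ) → (Fin ℓ → WithBot ℕ) → Prog (Fin ℓ → WithBot ℕ)
  | [], v => .done v
  | j :: t, v => (degreeProg j (d j)).bind fun e => degreesProg d t (Function.update v j e)

/-- The degrees of the first row. -/
def rowDegrees {ℓ : ℕ} (γ : Fin (ℓ + 1) → ℕ) (v : Fin ℓ → WithBot ℕ) : Fin (ℓ + 1) → WithBot ℕ :=
  Fin.cons (γ 0 : WithBot ℕ) fun i => v i + (γ i.succ : WithBot ℕ)

lemma argmax_nonempty {ℓ : ℕ} (w : Fin (ℓ + 1) → WithBot ℕ) :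
    (Finset.univ.filter fun i => w i = Finset.univ.sup w).Nonempty := by
  obtain ⟨i, -, hi⟩ := Finset.exists_mem_eq_sup Finset.univ Finset.univ_nonempty w
  exact ⟨i, Finset.mem_filter.2 ⟨Finset.mem_univ i, hi.symm⟩⟩

/-- The rightmost position of a maximum. -/
def argmax {ℓ : ℕ} (w : Fin (ℓ + 1) → WithBot ℕ) : Fin (ℓ + 1) :=
  (Finset.univ.filter fun i => w i = Finset.univ.sup w).max' (argmax_nonempty w)

/-- What is done before the loop once the degrees of the first row are known. -/
def enterProg {ℓ : ℕ} (γ : Fin (ℓ + 1) → ℕ) (d : Fin ℓ → ℕ) (w : Fin (ℓ + 1) → WithBot ℕ) :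
    Prog ((Fin (ℓ + 1) → List Addr) ⊕ Layout ℓ) :=
  Fin.cases
    (Prog.code [.one (lamReg 0 0)] (.done (Sum.inl fun j => if j = 0 then [lamReg 0 0] else [])))
    -- Working memory starts at 0, so only the coefficient of x^{γ_0} and the leading coefficients
    -- of the moduli, all equal to 1 for binomials, have to be written.
    (fun h => Prog.code (.one (lamReg 0 (γ 0)) :: (List.range ℓ).map fun j => .one (alphaReg j))
      (.done (Sum.inr (layoutAt (maxDegree γ d) (γ 0) (fun j => ((d j + γ j.succ : ℕ) : ℤ))
        ((((Finset.univ.sup w).unbotD 0 : ℕ) : ℤ), h)))))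
    (argmax w)

/-- The body of the loop at position `(e, h)`, when `λ_0` has degree `δ`. -/
def bodyProgAt {ℓ : ℕ} (γ : Fin (ℓ + 1) → ℕ) (d : Fin ℓ → ℕ) (δ : ℕ) (eta : Fin ℓ → ℤ) (e : ℤ)
    (h : Fin ℓ) : Prog (Layout ℓ) :=
  Prog.code (neededCode (γ 0) (γ h.succ) h (d h) (maxDegree γ d) e.toNat)
    (.ifZero accReg
      (.done (layoutAt (maxDegree γ d) δ eta (nextPos e h)))
      (if e < eta h then
        Prog.code (swapCode (maxDegree γ d + 1) (eta h - e).toNat h)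
          (.done (layoutAt (maxDegree γ d) (δ + (eta h - e).toNat) (Function.update eta h e)
            (nextPos (eta h) h)))
      else
        Prog.code (cancelCode (maxDegree γ d + 1) (e - eta h).toNat h)
          (.done (layoutAt (maxDegree γ d) δ eta (nextPos e h)))))

/-- A realisation of the demand-driven algorithm for binomials `g_i`. -/
def binomialRealisation : Realisation where
  start _ γ d := (degreesProg d (List.finRange _) fun _ => ⊥).bind fun v =>
    enterProg γ d (rowDegrees γ v)
  -- The length is δ + 1, so this is the comparison δ ≤ η of integers, free of charge.
  guard _ _ _ L := .done (decide (((L.lam 0).length : ℤ) ≤ L.etaCur + 1))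
  body _ γ d L := bodyProgAt γ d ((L.lam 0).length - 1) L.eta L.etaCur L.h
  -- Division by x^{γ_0} only shifts addresses.
  finish _ γ _ L := .done fun j => (L.lam j).drop (γ 0)

/-! ### The loop -/

section Loop

variable {F : Type*} [Field F] {ℓ : ℕ}

/-- The memory `m` holds the variables and the input of the algorithm at the standard places. -/
structure Holds (I : MgLSSR F ℓ) (σ : DDState F ℓ) (m : Addr → F) : Prop where
  lam : ∀ (j : Fin (ℓ + 1)) n, m (lamReg j n) = (σ.lam j).coeff n
  alpha : ∀ j : Fin ℓ, m (alphaReg j) = σ.alpha j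
  zero : m zeroReg = 0
  inS : ∀ (j : Fin ℓ) n, m (.inS j n) = (I.s j).coeff n
  inG : ∀ j : Fin ℓ, m (.inG j 0) = (I.g j).coeff 0

variable {I : MgLSSR F ℓ} {σ : DDState F ℓ} {m m' : Addr → F} {M δ : ℕ}

lemma Holds.advance (H : Holds I σ m) : Holds I σ.advance m := by
  rw [DDState.advance_eq]
  exact ⟨H.lam, H.alpha, H.zero, H.inS, H.inG⟩

lemma Holds.congr (H : Holds I σ m) (h : ∀ x, x ≠ accReg → x ≠ tmpReg → m' x = m x) :
    Holds I σ m' where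
  lam j n := by rw [h _ (by simp) (by simp), H.lam]
  alpha j := by rw [h _ (by simp) (by simp), H.alpha]
  zero := by rw [h _ (by simp) (by simp), H.zero]
  inS j n := by rw [h _ (by simp) (by simp), H.inS]
  inG j := by rw [h _ (by simp) (by simp), H.inG]

lemma stores_map_range {p : SkewPolynomial F} (f : ℕ → Addr) (N : ℕ)
    (h1 : ∀ n, m (f n) = p.coeff n) (h2 : ∀ n, N ≤ n → p.coeff n = 0) :
    Stores m ((List.range N).map f) p := by
  intro n
  rw [List.getElem?_map]
  rcases Nat.lt_or_ge n N with h | h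
  · simp [h, h1]
  · simp [h, h2 n h]

lemma Holds.stores_lam (H : Holds I σ m) {t : ℕ} (V : Invariant M t σ δ) (eta : Fin ℓ → ℤ)
    (p : ℤ × Fin ℓ) (j : Fin (ℓ + 1)) :
    Stores m ((layoutAt M δ eta p).lam j) (σ.lam j) := by
  refine stores_map_range _ _ (H.lam j) fun n hn => ?_
  induction j using Fin.cases with
  | zero => exact V.top n (by simpa using hn)
  | succ j =>
    rw [if_neg (Fin.succ_ne_zero j)] at hn
    exact not_ne_iff.1 (mt (V.lam_le j n) (by omega))

lemma Holds.represents (H : Holds I σ m) {t : ℕ} (V : Invariant M t σ δ) :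
    (layoutAt M δ σ.eta (σ.etaCur, σ.h)).Represents m σ :=
  ⟨H.stores_lam V _ _, H.alpha, rfl, rfl, rfl⟩

lemma length_layoutAt_lam (M δ : ℕ) (eta : Fin ℓ → ℤ) (p : ℤ × Fin ℓ) :
    ((layoutAt M δ eta p).lam 0).length = δ + 1 := by simp [layoutAt]

variable [MulSemiringAction (Multiplicative ℕ) F]

/-- The moduli are the binomials `x^{d_i} + a_i`, and `deg s_i ≤ d_i`. -/
structure IsBinomial (I : MgLSSR F ℓ) (d : Fin ℓ → ℕ) (a : Fin ℓ → F) : Prop where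
  pos : ∀ i, 0 < d i
  g_eq : ∀ i, I.g i = X ^ d i + C (a i)
  s_eq_zero : ∀ i n, d i < n → (I.s i).coeff n = 0

lemma IsBinomial.natDegree_eq {I : MgLSSR F ℓ} {d : Fin ℓ → ℕ} {a : Fin ℓ → F}
    (hI : IsBinomial I d a) : (fun i => natDegree (I.g i)) = d :=
  funext fun i => by rw [hI.g_eq, natDegree_X_pow_add_C (hI.pos i)]

lemma IsBinomial.mu_eq {I : MgLSSR F ℓ} {d : Fin ℓ → ℕ} {a : Fin ℓ → F}
    (hI : IsBinomial I d a) : I.mu = maxDegree I.γ d := by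
  rw [← hI.natDegree_eq]; rfl

lemma le_maxDegree (γ : Fin (ℓ + 1) → ℕ) (d : Fin ℓ → ℕ) (i : Fin ℓ) :
    γ i.succ + d i ≤ maxDegree γ d :=
  Finset.le_sup (f := fun i : Fin ℓ => γ i.succ + d i) (Finset.mem_univ i)

/-- The code treats only the coefficients up to x^M. The invariants before and after the operation
ensure that nothing lies beyond, so the untouched registers are still correct. -/
lemma Holds.swap (H : Holds I σ m) {t : ℕ} (V : Invariant M t σ δ)
    {δ' : ℕ} (V' : Invariant M σ.h (swapState σ (m accReg)) δ') :
    Holds I (swapState σ (m accReg))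
      (execList (swapCode (M + 1) (σ.eta σ.h - σ.etaCur).toNat σ.h) m) := by
  obtain ⟨h1, h2, h3, h4⟩ := exec_swapCode (M + 1) (σ.eta σ.h - σ.etaCur).toNat σ.h m H.zero
  have hlam : ∀ j n, ((swapState σ (m accReg)).lam (Fin.succ j)).coeff n ≠ 0 → n ≤ M := V'.lam_le
  constructor
  · intro j n
    induction j using Fin.cases with
    | zero =>
      rcases Nat.lt_or_ge n (M + 1) with hn | hn
      · have e1 := H.lam σ.h.succ n
        have e2 := H.lam 0 (n - (σ.eta σ.h - σ.etaCur).toNat)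
        rw [Fin.val_succ] at e1
        rw [swapState_coeff, ← e1, ← e2, ← H.alpha]
        exact h1 n hn
      · rw [V'.top n (by have := V'.deg_le; omega)]
        rw [h4 _ (by simp [IsScratch]) (by simp; omega) (by simp) (by simp), H.lam,
          V.top n (by have := V.deg_le; omega)]
    | succ j =>
      by_cases hj : j = σ.h
      · subst hj
        rcases Nat.lt_or_ge n (M + 1) with hn | hn
        · rw [swapState_lam_self, Fin.val_succ]
          exact (h2 n hn).trans (H.lam 0 n)
        · rw [not_ne_iff.1 (mt (hlam σ.h n) (by omega)),
            h4 _ (by simp [IsScratch]; omega) (by simp) (by simp; omega) (by simp; omega), H.lam]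
          exact not_ne_iff.1 (mt (V.lam_le σ.h n) (by omega))
      · have hj' : j.val ≠ σ.h.val := fun h => hj (Fin.ext h)
        rw [swapState_lam_of_ne _ _ hj, h4 _ (by simp [IsScratch]; omega) (by simp)
          (by simp [hj']) (by simp; omega), H.lam]
  · intro j
    by_cases hj : j = σ.h
    · subst hj
      rw [h3]
      simp [swapState]
    · have hj' : j.val ≠ σ.h.val := fun h => hj (Fin.ext h)
      rw [h4 _ (by simp [IsScratch]) (by simp) (by intro n _; simp; omega) (by simp [hj']), H.alpha]
      simp [swapState, hj]
  · rw [h4 _ (by simp [IsScratch]) (by simp) (by simp) (by simp), H.zero]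
  · intro j n
    rw [h4 _ (by simp [IsScratch]) (by simp) (by simp) (by simp), H.inS]
  · intro j
    rw [h4 _ (by simp [IsScratch]) (by simp) (by simp) (by simp), H.inG]

lemma Holds.cancel (H : Holds I σ m) {t : ℕ} (V : Invariant M t σ δ)
    {δ' : ℕ} (V' : Invariant M σ.h (cancelState σ (m accReg)) δ') :
    Holds I (cancelState σ (m accReg))
      (execList (cancelCode (M + 1) (σ.etaCur - σ.eta σ.h).toNat σ.h) m) := by
  obtain ⟨h1, h4⟩ := exec_cancelCode (M + 1) (σ.etaCur - σ.eta σ.h).toNat σ.h m H.zero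
  constructor
  · intro j n
    induction j using Fin.cases with
    | zero =>
      rcases Nat.lt_or_ge n (M + 1) with hn | hn
      · have e1 := H.lam σ.h.succ (n - (σ.etaCur - σ.eta σ.h).toNat)
        have e2 := H.lam 0 n
        rw [Fin.val_succ] at e1
        rw [cancelState_coeff, ← e1, ← e2, ← H.alpha]
        exact h1 n hn
      · rw [V'.top n (by have := V'.deg_le; omega)]
        rw [h4 _ (by simp [IsScratch]) (by simp; omega), H.lam,
          V.top n (by have := V.deg_le; omega)]
    | succ j =>
      rw [cancelState_lam_succ, h4 _ (by simp [IsScratch]; omega) (by simp), H.lam]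
  · intro j
    rw [h4 _ (by simp [IsScratch]) (by simp), H.alpha]
    rfl
  · rw [h4 _ (by simp [IsScratch]) (by simp), H.zero]
  · intro j n
    rw [h4 _ (by simp [IsScratch]) (by simp), H.inS]
  · intro j
    rw [h4 _ (by simp [IsScratch]) (by simp), H.inG]

/-- One pass: 28M instructions for the needed coefficient, one test, and at most 5(M + 1) + 3 for
the row operation, hence at most 33M + 9 ≤ 42M as M ≥ 1. -/
lemma run_bodyProgAt {d : Fin ℓ → ℕ} {a : Fin ℓ → F} (hI : IsBinomial I d a)
    (V : Invariant (maxDegree I.γ d) (σ.h + 1) σ δ) (H : Holds I σ m)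
    (hδ : (δ : ℤ) ≤ σ.etaCur) :
    ∃ δ' m' c, (bodyProgAt I.γ d δ σ.eta σ.etaCur σ.h).run m =
        (layoutAt (maxDegree I.γ d) δ' (I.step σ).eta ((I.step σ).etaCur, (I.step σ).h), m', c) ∧
      Invariant (maxDegree I.γ d) ((I.step σ).h + 1) (I.step σ) δ' ∧ Holds I (I.step σ) m' ∧
      c ≤ 42 * maxDegree I.γ d ∧
      rank δ' (I.step σ).etaCur (I.step σ).h = rank δ σ.etaCur σ.h - 1 := by
  have hdM := (Nat.le_add_left _ _).trans (le_maxDegree I.γ d σ.h)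
  have hd := hI.pos σ.h
  generalize hM : maxDegree I.γ d = M at *
  have hinG : m (.inG σ.h 0) = a σ.h := by
    rw [H.inG, hI.g_eq, coeff_X_pow_add_C hd, if_neg hd.ne, if_pos rfl]
  obtain ⟨n1, n2⟩ := exec_neededCode (I.γ 0) (I.γ σ.h.succ) σ.h (d σ.h) M σ.etaCur.toNat m
    (σ.lam 0) (I.s σ.h) (a σ.h) H.zero hinG (H.inS σ.h) (H.lam 0) (hI.s_eq_zero σ.h) hd
    fun n hn => V.top n (by have := V.deg_le; omega)
  have hlen := length_neededCode (I.γ 0) (I.γ σ.h.succ) σ.h (d σ.h) M σ.etaCur.toNat hd hdM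
  rw [← hI.g_eq] at n1
  change _ = I.neededCoeff σ at n1
  have H₁ := H.congr n2
  rw [bodyProgAt, Prog.run_code, hM]
  generalize execList (neededCode (I.γ 0) (I.γ σ.h.succ) σ.h (d σ.h) M σ.etaCur.toNat) m = m₁
    at n1 H₁
  rw [MgLSSR.step_eq, Prog.run]
  by_cases h0 : I.neededCoeff σ = 0
  · have W := (V.mono (Nat.le_succ _)).advance
    have H' := H₁.advance
    rw [if_pos (n1.trans h0), if_pos h0]
    rw [DDState.advance_eq] at W H' ⊢
    refine ⟨δ, _, _, rfl, W, H', ?_, rank_nextPos _ _ _⟩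
    simp only [Prog.run, Prog.run.tick]
    omega
  · rw [if_neg (fun h => h0 (n1.symm.trans h)), if_neg h0]
    by_cases hlt : σ.etaCur < σ.eta σ.h
    · have V' := V.swap h0 hδ hlt
      have H' := H₁.swap V (n1.symm ▸ V')
      rw [n1] at H'
      have W := Invariant.advance (σ := swapState σ (I.neededCoeff σ)) V'
      have H'' := H'.advance
      have hl := length_swapCode (M + 1) (σ.eta σ.h - σ.etaCur).toNat σ.h
      rw [if_pos hlt, if_pos hlt, Prog.run_code]
      rw [DDState.advance_eq] at W H'' ⊢
      refine ⟨_, _, _, rfl, W, H'', ?_, (rank_nextPos _ _ _).trans ?_⟩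
      · simp only [Prog.run, Prog.run.tick]
        omega
      -- A swap raises δ and η by the same amount, so it leaves the rank alone.
      · have : (((σ.eta σ.h - σ.etaCur).toNat : ℕ) : ℤ) = σ.eta σ.h - σ.etaCur := by omega
        simp only [rank, swapState]
        push_cast [this]
        ring
    · have V' := V.cancel (I.neededCoeff σ) (not_lt.1 hlt)
      have H' := H₁.cancel V (n1.symm ▸ V')
      rw [n1] at H'
      have W := Invariant.advance (σ := cancelState σ (I.neededCoeff σ)) V'
      have H'' := H'.advance
      have hl := length_cancelCode (M + 1) (σ.etaCur - σ.eta σ.h).toNat σ.h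
      rw [if_neg hlt, if_neg hlt, Prog.run_code]
      rw [DDState.advance_eq] at W H'' ⊢
      refine ⟨_, _, _, rfl, W, H'', ?_, rank_nextPos _ _ _⟩
      simp only [Prog.run, Prog.run.tick]
      omega

lemma follows_binomialRealisation {d : Fin ℓ → ℕ} {a : Fin ℓ → F} (hI : IsBinomial I d a)
    (N : ℕ) : ∀ (σ : DDState F ℓ) (δ : ℕ) (m : Addr → F),
    Invariant (maxDegree I.γ d) (σ.h + 1) σ δ → Holds I σ m → rank δ σ.etaCur σ.h ≤ N →
    ∃ c, binomialRealisation.Follows I σ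
        (layoutAt (maxDegree I.γ d) δ σ.eta (σ.etaCur, σ.h)) m c ∧
      c ≤ 42 * maxDegree I.γ d * N := by
  induction N with
  | zero =>
    intro σ δ m V H hr
    -- If δ ≤ η, the rank would be at least h + 1 > 0.
    have hδ : ¬ (δ : ℤ) ≤ σ.etaCur := by
      intro hδ
      have : (0 : ℤ) ≤ ℓ * (σ.etaCur - δ) := mul_nonneg (by omega) (by omega)
      simp only [rank] at hr
      omega
    exact ⟨_, exit V H hδ, by simp⟩
  | succ N ih =>
    intro σ δ m V H hr
    by_cases hδ : (δ : ℤ) ≤ σ.etaCur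
    · obtain ⟨δ', m', c, h1, V', H', hc, hr'⟩ := run_bodyProgAt hI V H hδ
      obtain ⟨c', hf, hc'⟩ := ih (I.step σ) δ' m' V' H' (by push_cast at hr; omega)
      refine ⟨0 + c + c', .pass (m₁ := m) (H.represents V) (V.continues_iff.2 hδ) ?_ ?_ hf, ?_⟩
      · change (_, _, _) = _
        rw [length_layoutAt_lam]
        simpa [layoutAt] using hδ
      · rw [hI.natDegree_eq]
        change (bodyProgAt _ _ _ _ _ _).run m = _
        rw [length_layoutAt_lam]
        exact h1
      · rw [Nat.mul_succ]; omega
    · exact ⟨_, exit V H hδ, by simp⟩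
where
  exit {I : MgLSSR F ℓ} {σ : DDState F ℓ} {m : Addr → F} {M δ t : ℕ} (V : Invariant M t σ δ)
      (H : Holds I σ m) (hδ : ¬ (δ : ℤ) ≤ σ.etaCur) :
      binomialRealisation.Follows I σ (layoutAt M δ σ.eta (σ.etaCur, σ.h)) m (0 + 0) := by
    refine .exit (m₁ := m) (m₂ := m) (H.represents V) (mt V.continues_iff.1 hδ) ?_ rfl ?_
    · change (_, _, _) = _
      rw [length_layoutAt_lam]
      simpa [layoutAt] using hδ
    · intro j n
      have := H.stores_lam V σ.eta (σ.etaCur, σ.h) j (n + I.γ 0)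
      rw [MgLSSR.result, coeff_divXPow, this, List.getElem?_drop, add_comm]

end Loop

/-! ### Before the loop -/

section Start

variable {F : Type*} [Field F] [MulSemiringAction (Multiplicative ℕ) F] {ℓ : ℕ}

lemma run_degreeProg (j : ℕ) (m : Addr → F) (s : SkewPolynomial F)
    (hm : ∀ n, m (.inS j n) = s.coeff n) :
    ∀ D, (∀ n, D < n → s.coeff n = 0) →
      ∃ c, (degreeProg j D).run m = (degree s, m, c) ∧ c ≤ D + 1
  | 0, hD => by
    refine ⟨1, ?_, le_rfl⟩
    rw [degreeProg, Prog.run, hm]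
    split_ifs with h
    · rw [(degree_eq_bot_iff s).2 fun n => by
        rcases n.eq_zero_or_pos with rfl | hn
        · exact h
        · exact hD n hn]
      rfl
    · rw [degree_eq_coe h hD]
      rfl
  | D + 1, hD => by
    rw [degreeProg, Prog.run, hm]
    split_ifs with h
    · obtain ⟨c, hc, hcD⟩ := run_degreeProg j m s hm D fun n hn => by
        rcases Nat.lt_or_ge (D + 1) n with hn' | hn'
        · exact hD n hn'
        · rwa [show n = D + 1 by omega]
      exact ⟨c + 1, by rw [hc]; rfl, by omega⟩
    · refine ⟨1, ?_, by omega⟩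
      rw [degree_eq_coe h hD]
      rfl

lemma run_degreesProg {I : MgLSSR F ℓ} {d : Fin ℓ → ℕ} (hs : ∀ i n, d i < n → (I.s i).coeff n = 0)
    {M : ℕ} (hM : ∀ i, d i ≤ M) :
    ∀ (l : List (Fin ℓ)) (v : Fin ℓ → WithBot ℕ),
      ∃ c, (degreesProg d l v).run I.inputMemory =
          (fun j => if j ∈ l then degree (I.s j) else v j, I.inputMemory, c) ∧
        c ≤ l.length * (M + 1)
  | [], v => ⟨0, by simp [degreesProg, Prog.run], by simp⟩
  | j :: t, v => by
    obtain ⟨c, hc, hcD⟩ := run_degreeProg j I.inputMemory (I.s j)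
      (fun n => by simp [MgLSSR.inputMemory]) (d j) (hs j)
    obtain ⟨c', hc', hcD'⟩ := run_degreesProg hs hM t (Function.update v j (degree (I.s j)))
    refine ⟨c' + c, ?_, ?_⟩
    · rw [degreesProg, Prog.run_bind, hc]
      simp only [hc']
      congr 1
      funext i
      by_cases hij : i = j
      · subst hij; simp
      · simp [hij]
    · have := hM j
      rw [List.length_cons, add_mul]
      omega

lemma rowDegrees_eq (I : MgLSSR F ℓ) :
    (rowDegrees I.γ fun j => degree (I.s j)) = fun i => degree (I.firstRow i) := by
  funext i
  induction i using Fin.cases with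
  | zero => simp [rowDegrees, MgLSSR.firstRow, degree_X_pow]
  | succ i => simp [rowDegrees, MgLSSR.firstRow, MgLSSR.sTilde, degree_mul_X_pow]

lemma exec_ones (m : Addr → F) (f : ℕ → Addr) (N : ℕ) :
    (∀ n < N, execList ((List.range N).map fun n => .one (f n)) m (f n) = 1) ∧
      ∀ x, (∀ n < N, x ≠ f n) → execList ((List.range N).map fun n => .one (f n)) m x = m x := by
  induction N with
  | zero => simp
  | succ N ih =>
    rw [List.range_succ, List.map_append, execList_append]
    obtain ⟨h1, h2⟩ := ih
    constructor
    · intro n hn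
      -- The addresses need not be distinct: a register written twice still holds 1.
      by_cases h : f n = f N
      · simp [Instr.exec, h]
      · have : n ≠ N := fun e => h (by rw [e])
        simp [Instr.exec, h, h1 n (by omega)]
    · intro x hx
      simp [Instr.exec, hx N (by omega), h2 x fun n hn => hx n (by omega)]

lemma coeff_gTilde {I : MgLSSR F ℓ} {d : Fin ℓ → ℕ} {a : Fin ℓ → F} (hI : IsBinomial I d a)
    (j : Fin ℓ) : (I.gTilde j).coeff (d j + I.γ j.succ) = 1 ∧
      ∀ n, d j + I.γ j.succ < n → (I.gTilde j).coeff n = 0 := by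
  rw [MgLSSR.gTilde, hI.g_eq]
  refine ⟨?_, fun n hn => ?_⟩
  · rw [coeff_mul_X_pow, if_pos (by omega), Nat.add_sub_cancel, coeff_X_pow_add_C (hI.pos j),
      if_pos rfl]
  · rw [coeff_mul_X_pow, if_pos (by omega), coeff_X_pow_add_C (hI.pos j), if_neg (by omega),
      if_neg (by omega)]

lemma natDegree_gTilde {I : MgLSSR F ℓ} {d : Fin ℓ → ℕ} {a : Fin ℓ → F} (hI : IsBinomial I d a)
    (j : Fin ℓ) : natDegree (I.gTilde j) = d j + I.γ j.succ := by
  obtain ⟨h1, h2⟩ := coeff_gTilde hI j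
  exact natDegree_eq (by rw [h1]; exact one_ne_zero) h2

lemma leadingCoeff_gTilde {I : MgLSSR F ℓ} {d : Fin ℓ → ℕ} {a : Fin ℓ → F}
    (hI : IsBinomial I d a) (j : Fin ℓ) : leadingCoeff (I.gTilde j) = 1 := by
  rw [leadingCoeff, natDegree_gTilde hI, (coeff_gTilde hI j).1]

/-- The state in which the loop is entered, for binomials `g_i`. -/
noncomputable def initState (I : MgLSSR F ℓ) (d : Fin ℓ → ℕ) (h : Fin ℓ) : DDState F ℓ where
  lam := Fin.cons (X ^ I.γ 0) fun _ => 0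
  alpha := fun _ => 1
  eta := fun j => ((d j + I.γ j.succ : ℕ) : ℤ)
  etaCur := ((vecDegree I.firstRow).unbotD 0 : ℕ)
  h := h

lemma init_eq {I : MgLSSR F ℓ} {d : Fin ℓ → ℕ} {a : Fin ℓ → F} (hI : IsBinomial I d a) :
    I.init = Fin.cases none (fun h => some (initState I d h)) (leadingPosition I.firstRow) := by
  simp only [MgLSSR.init, leadingCoeff_gTilde hI, natDegree_gTilde hI, initState]

/-- Since the leading position is not 0, the degree of the row is that of some s_h x^{γ_h}, hence at
most γ_h + d_h. This bounds γ_0 as well, although γ_0 does not enter the definition of μ. -/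
lemma vecDegree_bounds {I : MgLSSR F ℓ} {d : Fin ℓ → ℕ} {a : Fin ℓ → F} (hI : IsBinomial I d a)
    {h : Fin ℓ} (hh : leadingPosition I.firstRow = h.succ) :
    I.γ 0 ≤ (vecDegree I.firstRow).unbotD 0 ∧
      (vecDegree I.firstRow).unbotD 0 ≤ maxDegree I.γ d := by
  have h1 : degree (I.firstRow h.succ) = vecDegree I.firstRow := by
    have := Finset.max'_mem _ (leadingPositions_nonempty I.firstRow)
    rw [← hh]
    exact (Finset.mem_filter.1 this).2
  have h2 : degree (I.firstRow 0) ≤ vecDegree I.firstRow :=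
    Finset.le_sup (f := fun i => degree (I.firstRow i)) (Finset.mem_univ 0)
  have h3 : degree (I.firstRow 0) = (I.γ 0 : WithBot ℕ) := degree_X_pow _
  have h4 : degree (I.firstRow h.succ) < ((d h + I.γ h.succ + 1 : ℕ) : WithBot ℕ) := by
    rw [degree_lt_iff]
    intro n hn
    change (I.s h * X ^ I.γ h.succ).coeff n = 0
    rw [coeff_mul_X_pow, if_pos (by omega), hI.s_eq_zero h _ (by omega)]
  rw [h1] at h4
  rw [h3] at h2
  have h5 := le_maxDegree I.γ d h
  cases hv : vecDegree I.firstRow with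
  | bot => rw [hv] at h2; exact absurd (le_bot_iff.1 h2) (WithBot.coe_ne_bot)
  | coe D =>
    rw [hv] at h2 h4
    have h2' := WithBot.coe_le_coe.1 h2
    have h4' := WithBot.coe_lt_coe.1 h4
    rw [WithBot.unbotD_coe]
    exact ⟨h2', by simp only [Nat.cast_id] at *; omega⟩

/-- All λ_j with j ≥ 1 are 0 at the start, so the inequalities, strict ones included, hold vacuously
for every t. -/
lemma Invariant.init {I : MgLSSR F ℓ} {d : Fin ℓ → ℕ} {a : Fin ℓ → F} (hI : IsBinomial I d a)
    {h : Fin ℓ} (hh : leadingPosition I.firstRow = h.succ) (t : ℕ) :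
    Invariant (maxDegree I.γ d) t (initState I d h) (I.γ 0) := by
  obtain ⟨h1, h2⟩ := vecDegree_bounds hI hh
  constructor
  · simp [initState, coeff_X_pow]
  · intro n hn
    simp [initState, coeff_X_pow, hn.ne]
  · simp [initState]
  · intro j
    have := le_maxDegree I.γ d j
    simp only [initState]
    omega
  · simp only [initState]
    omega
  · omega
  all_goals simp [initState]

end Start

/-- The demand-driven algorithm for binomials `g_i` has complexity `O(ℓ μ ^ 2)`. -/
theorem realises_binomialRealisation {F : Type*} [Field F] [MulSemiringAction (Multiplicative ℕ) F]
    {ℓ : ℕ} {I : MgLSSR F ℓ} {d : Fin ℓ → ℕ} {a : Fin ℓ → F} (hℓ : 0 < ℓ)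
    (hI : IsBinomial I d a) :
    ∃ c, binomialRealisation.Realises I c ∧ c ≤ 88 * (ℓ * I.mu ^ 2) := by
  have hdM : ∀ i, d i ≤ maxDegree I.γ d := fun i =>
    (Nat.le_add_left _ _).trans (le_maxDegree I.γ d i)
  have hM : 1 ≤ maxDegree I.γ d := (hI.pos ⟨0, hℓ⟩).trans_le (hdM _)
  obtain ⟨c₀, hrun, hc₀⟩ := run_degreesProg hI.s_eq_zero hdM (List.finRange ℓ) fun _ => ⊥
  simp only [List.mem_finRange, if_true, List.length_finRange] at hrun hc₀
  have hstart : (binomialRealisation.start ℓ I.γ fun i => natDegree (I.g i)).run I.inputMemory =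
      (((enterProg I.γ d fun i => degree (I.firstRow i)).run I.inputMemory).1,
        ((enterProg I.γ d fun i => degree (I.firstRow i)).run I.inputMemory).2.1,
        ((enterProg I.γ d fun i => degree (I.firstRow i)).run I.inputMemory).2.2 + c₀) := by
    rw [hI.natDegree_eq]
    simp only [binomialRealisation]
    rw [Prog.run_bind, hrun, rowDegrees_eq]
  have hpos : argmax (fun i => degree (I.firstRow i)) = leadingPosition I.firstRow := rfl
  have hinit := init_eq hI
  rw [hI.mu_eq]
  have b1 : ℓ ≤ ℓ * maxDegree I.γ d ^ 2 := Nat.le_mul_of_pos_right _ (by positivity)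
  have b2 : ℓ * maxDegree I.γ d ≤ ℓ * maxDegree I.γ d ^ 2 :=
    Nat.mul_le_mul_left _ (Nat.le_self_pow two_ne_zero _)
  rw [mul_add, mul_one] at hc₀
  rw [enterProg, hpos] at hstart
  unfold Realisation.Realises
  generalize hp : leadingPosition I.firstRow = p at hstart hinit
  induction p using Fin.cases with
  | zero =>
    simp only [Fin.cases_zero] at hinit hstart
    rw [Prog.run_code] at hstart
    rw [hinit]
    refine ⟨_, ⟨_, _, hstart, ?_⟩, ?_⟩
    · intro j n
      induction j using Fin.cases with
      | zero =>
        rcases n with _ | n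
        · simp [Prog.run, Instr.exec, MgLSSR.trivialResult]
        · simp [Prog.run, MgLSSR.trivialResult, coeff_one]
      | succ j => simp [Prog.run, MgLSSR.trivialResult]
    · simp only [Prog.run, List.length_cons, List.length_nil]
      omega
  | succ h =>
    simp only [Fin.cases_succ] at hinit hstart
    rw [Prog.run_code] at hstart
    rw [hinit]
    obtain ⟨e1, e2⟩ := exec_ones (Instr.exec I.inputMemory (.one (lamReg 0 (I.γ 0))))
      (fun j => alphaReg j) ℓ
    have V := Invariant.init hI hp (h + 1)
    have H : Holds I (initState I d h) (execList (.one (lamReg 0 (I.γ 0)) ::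
        (List.range ℓ).map fun j => .one (alphaReg j)) I.inputMemory) := by
      rw [execList_cons]
      constructor
      · intro j n
        rw [e2 _ (by simp; omega)]
        induction j using Fin.cases with
        | zero =>
          simp only [Instr.exec, initState, Fin.cons_zero, coeff_X_pow, Function.update_apply]
          simp [reg, MgLSSR.inputMemory, eq_comm]
        | succ j => simp [Instr.exec, initState, reg, MgLSSR.inputMemory]
      · exact fun j => e1 j j.isLt
      · rw [e2 _ (by simp)]
        simp [Instr.exec, reg, MgLSSR.inputMemory]
      · intro j n
        rw [e2 _ (by simp)]
        simp [Instr.exec, MgLSSR.inputMemory]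
      · intro j
        rw [e2 _ (by simp)]
        simp [Instr.exec, MgLSSR.inputMemory]
    -- The initial rank ℓ(η − γ_0) + h + 1 is at most ℓM + ℓ, and ℓ ≤ ℓM because M ≥ 1.
    obtain ⟨c, hf, hc⟩ := follows_binomialRealisation hI (2 * (ℓ * maxDegree I.γ d)) _ _ _ V H (by
      have h1 := (vecDegree_bounds hI hp).2
      have h2 : (ℓ : ℤ) * (((vecDegree I.firstRow).unbotD 0 : ℕ) - (I.γ 0 : ℕ)) ≤
          ℓ * maxDegree I.γ d := mul_le_mul_of_nonneg_left (by omega) (by omega)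
      have h3 : ((ℓ * 1 : ℕ) : ℤ) ≤ ((ℓ * maxDegree I.γ d : ℕ) : ℤ) :=
        Int.ofNat_le.2 (Nat.mul_le_mul_left _ hM)
      have := h.isLt
      simp only [rank, initState]
      push_cast at h3 ⊢
      omega)
    refine ⟨_, ⟨_, _, _, _, hstart, hf, rfl⟩, ?_⟩
    -- The loop accounts for 84 of the constant 88; the other 4 absorb the at most ℓ(M + 1) + ℓ + 1
    -- instructions before it.
    have h4 : 42 * maxDegree I.γ d * (2 * (ℓ * maxDegree I.γ d)) =
        84 * (ℓ * maxDegree I.γ d ^ 2) := by ring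
    simp only [Prog.run, List.length_cons, List.length_map, List.length_range]
    omega

end SkewRowReduction

theorem mainTheorem7 :
    ∃ (P : SkewRowReduction.Realisation) (K : ℕ),
      ∀ (F : Type*) [Field F] [Finite F] [MulSemiringAction (Multiplicative ℕ) F]
        (ℓ : ℕ) (I : SkewRowReduction.MgLSSR F ℓ) (d : Fin ℓ → ℕ) (a : Fin ℓ → F),
        0 < ℓ →
        (∀ i, 0 < d i) →
        (∀ i, I.g i = SkewPolynomial.X ^ d i + SkewPolynomial.C (a i)) →
        (∀ i, SkewRowReduction.degree (I.s i) ≤ SkewRowReduction.degree (I.g i)) →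
        ∃ c : ℕ, P.Realises I c ∧ c ≤ K * (ℓ * I.mu ^ 2) := by
  refine ⟨SkewRowReduction.binomialRealisation, 88, fun F _ _ _ ℓ I d a hℓ hd hg hs => ?_⟩
  refine SkewRowReduction.realises_binomialRealisation (d := d) (a := a) hℓ ⟨hd, hg, fun i => ?_⟩
  have h := hs i
  rw [hg, SkewRowReduction.degree_X_pow_add_C (hd i)] at h
  refine (SkewRowReduction.degree_lt_iff _ (d i + 1)).1 (h.trans_lt ?_)
  exact_mod_cast Nat.lt_succ_self (d i)
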